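/- There are universal constants $C, K > 0$ such that the following holds. Let $n, m$ be natural numbers, let $x_0 \in \mathbb{C}^n$ with $\|x_0\| = 1$, let $\epsilon \in (0,1]$, and suppose that $$m \ge \frac{C}{\epsilon^2}\, n \log n .$$ Let $a^1_i, a^2_i$, $i = 1, \dots, m$, be $2m$ independent random vectors in $\mathbb{C}^n$, each with the complex Gaussian law $\mathcal{N}(0, \tfrac12 I_n) + i\,\mathcal{N}(0, \tfrac12 I_n)$ (independent real and imaginary parts). Put $$b^j_i = |\langle a^j_i, x_0\rangle|^2, \qquad R^j_i = \frac{b^j_i}{b^1_i + b^2_i}, \qquad y_i = \mathrm{sign}(b^1_i - b^2_i) \in \{-1, 1\}, \qquad j = 1,2,$$ and $$\hat{C}_m = \frac{1}{m}\sum_{i=1}^m y_i\left(R^1_i\, a^1_i (a^1_i)^* - R^2_i\, a^2_i (a^2_i)^*\right).$$ Then, with probability at least $1 - K n^{-2}$, every solution $\hat{x}_m$ of $$\max_{\|x\| = 1} x^* \hat{C}_m x$$ (that is, every unit eigenvector of $\hat{C}_m$ for its largest eigenvalue) satisfies $$\|\hat{x}_m - e^{i\phi} x_0\|^2 \le \epsilon$$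 for some global phase $\phi \in [0, 2\pi]$. -/

import Mathlib

open scoped NNReal ENNReal

noncomputable section

namespace OneBitPhase

open MeasureTheory ProbabilityTheory

/-- The law `𝒩(0, ½ Iₙ) + i 𝒩(0, ½ Iₙ)` on `ℂⁿ`: the real part and the imaginary part are
independent real Gaussian vectors with independent coordinates of mean `0` and variance `1/2`. -/
def complexGaussian (n : ℕ) : Measure (EuclideanSpace ℂ (Fin n)) :=
  ((Measure.pi fun _ : Fin n => gaussianReal 0 (1 / 2 : ℝ≥0)).prod
    (Measure.pi fun _ : Fin n => gaussianReal 0 (1 / 2 : ℝ≥0))).map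
      fun p => WithLp.toLp 2 fun k => (⟨p.1 k, p.2 k⟩ : ℂ)

/-- The phase-less measurement (intensity) `b = |⟨a, x₀⟩|²`. -/
def intensity {n : ℕ} (x₀ a : EuclideanSpace ℂ (Fin n)) : ℝ :=
  ‖inner ℂ a x₀‖ ^ 2

/-- The one-bit quantization `y = sign (b¹ - b²) ∈ {-1, 1}` of a pair of intensities. -/
def bit (b₁ b₂ : ℝ) : ℝ :=
  if b₂ ≤ b₁ then 1 else -1

/-- The rank one matrix `a a*`. -/
def outer {n : ℕ} (a : EuclideanSpace ℂ (Fin n)) : Matrix (Fin n) (Fin n) ℂ :=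
  Matrix.vecMulVec a.ofLp (star a.ofLp)

/-- The contribution `y (R¹ a¹ a¹* - R² a² a²*)` of a pair `(a¹, a²)` of sensing vectors,
where `Rʲ = bʲ / (b¹ + b²)` and `y = sign (b¹ - b²)`. -/
def pairMatrix {n : ℕ} (x₀ a₁ a₂ : EuclideanSpace ℂ (Fin n)) : Matrix (Fin n) (Fin n) ℂ :=
  let b₁ := intensity x₀ a₁
  let b₂ := intensity x₀ a₂
  bit b₁ b₂ • ((b₁ / (b₁ + b₂)) • outer a₁ - (b₂ / (b₁ + b₂)) • outer a₂)

/-- The weighted one-bit matrix `(1/m) ∑ᵢ yᵢ (R¹ᵢ a¹ᵢ a¹ᵢ* - R²ᵢ a²ᵢ a²ᵢ*)`;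
the vectors `a¹ᵢ`, `a²ᵢ` are `a (i, 0)`, `a (i, 1)`. -/
def weightedMatrix {n m : ℕ} (x₀ : EuclideanSpace ℂ (Fin n))
    (a : Fin m × Fin 2 → EuclideanSpace ℂ (Fin n)) : Matrix (Fin n) (Fin n) ℂ :=
  (1 / (m : ℝ)) • ∑ i : Fin m, pairMatrix x₀ (a (i, 0)) (a (i, 1))

/-- The quadratic form `x* M x`, which is real when `M` is Hermitian. -/
def quadForm {n : ℕ} (M : Matrix (Fin n) (Fin n) ℂ) (x : EuclideanSpace ℂ (Fin n)) : ℝ :=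
  (star x.ofLp ⬝ᵥ M.mulVec x.ofLp).re

/-- `x` solves the maximum eigenvalue problem `max_{‖x‖ = 1} x* M x`. -/
def IsTopEigenvector {n : ℕ} (M : Matrix (Fin n) (Fin n) ℂ)
    (x : EuclideanSpace ℂ (Fin n)) : Prop :=
  ‖x‖ = 1 ∧ ∀ z : EuclideanSpace ℂ (Fin n), ‖z‖ = 1 → quadForm M z ≤ quadForm M x

end OneBitPhase

end

/-!
The matrix `Ĉ_m` concentrates around a mean matrix with a spike along `x₀`, and the spectral gap of
the mean turns closeness of the matrices into closeness of the top eigenvectors.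

The mean. By isotropy, the components of a Gaussian vector along `x₀` and along a direction
orthogonal to `x₀` are independent (`indepFun_inner`), so `𝔼[u* Ĉ_m u] = B + (A - B) |⟨x₀, u⟩|²`
for unit `u` (`integral_pairForm`), with `A = 𝔼|b¹ - b²|` and `B = 𝔼[|b¹ - b²| / (b¹ + b²)]`.
These constants do not depend on the dimension, and only `A > B` matters; it follows without
evaluating them, from the behaviour of the Gaussian law under dilations (`meanAcross_le`).

Concentration. As `R¹, R² ∈ [0, 1]`, the form of one pair in a fixed unit direction `u` is at most
`|⟨a¹, u⟩|² + |⟨a², u⟩|²` in absolute value, which has exponential moments independent of `n`. Hence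
Bernstein's inequality bounds the deviation of `u* Ĉ_m u` from its mean
(`measure_abs_quadForm_gt_le`). A union bound over a `1/2`-net of the sphere with at most `25 ^ n`
points, affordable because `m ε²` is at least a large multiple of `n log n`, makes the deviation
small in all directions (`abs_quadForm_le_of_net`).

Perturbation. If the deviation is at most `r` on the sphere, comparing the form at a top
eigenvector `x` and at `x₀` gives `(A - B) (1 - |⟨x₀, x⟩|²) ≤ 2 r`, and the best phase has
`‖x - e^{iφ} x₀‖² = 2 - 2 |⟨x₀, x⟩|` (`exists_phase_of_isTopEigenvector`).
-/

namespace OneBitPhase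

open MeasureTheory ProbabilityTheory WithLp

/-! ### Characteristic functions and projections of complex Gaussian vectors -/

/-- The law of a standard complex Gaussian number, whose real and imaginary parts are independent
of mean `0` and variance `1/2`; it is the law of one coordinate under `complexGaussian`. -/
noncomputable def complexNormal : Measure ℂ :=
  ((gaussianReal 0 (1 / 2 : ℝ≥0)).prod (gaussianReal 0 (1 / 2 : ℝ≥0))).map
    fun p => (⟨p.1, p.2⟩ : ℂ)

lemma measurable_complex_mk : Measurable fun p : ℝ × ℝ => (⟨p.1, p.2⟩ : ℂ) :=
  Complex.measurableEquivRealProd.symm.measurable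

lemma measurable_toLp_complex_mk (n : ℕ) :
    Measurable fun p : (Fin n → ℝ) × (Fin n → ℝ) =>
      (toLp 2 fun k => (⟨p.1 k, p.2 k⟩ : ℂ) : EuclideanSpace ℂ (Fin n)) := by
  refine (PiLp.continuous_toLp 2 _).measurable.comp (measurable_pi_lambda _ fun k => ?_)
  exact measurable_complex_mk.comp (by fun_prop : Measurable fun p : (Fin n → ℝ) × (Fin n → ℝ) =>
    (p.1 k, p.2 k))

instance : IsProbabilityMeasure complexNormal :=
  Measure.isProbabilityMeasure_map measurable_complex_mk.aemeasurable

instance (n : ℕ) : IsProbabilityMeasure (complexGaussian n) :=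
  Measure.isProbabilityMeasure_map (measurable_toLp_complex_mk n).aemeasurable

lemma charFun_complexNormal (t : ℂ) :
    charFun complexNormal t = Complex.exp (-(‖t‖ ^ 2 / 4 : ℝ)) := by
  rw [charFun_apply, complexNormal, integral_map measurable_complex_mk.aemeasurable
    (by fun_prop)]
  have h (p : ℝ × ℝ) : Complex.exp ((inner ℝ (⟨p.1, p.2⟩ : ℂ) t : ℝ) * Complex.I) =
      Complex.exp (t.re * p.1 * Complex.I) * Complex.exp (t.im * p.2 * Complex.I) := by
    rw [← Complex.exp_add, Complex.inner]
    congr 1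
    simp
    ring
  simp_rw [h]
  rw [integral_prod_mul (fun x : ℝ => Complex.exp (t.re * x * Complex.I))
    (fun x : ℝ => Complex.exp (t.im * x * Complex.I)), ← charFun_apply_real, ← charFun_apply_real,
    charFun_gaussianReal, charFun_gaussianReal, ← Complex.exp_add, Complex.sq_norm,
    Complex.normSq_apply]
  congr 1
  push_cast
  ring

/-- The coordinates of a complex Gaussian vector are independent standard complex Gaussians. -/
lemma complexGaussian_eq_map_pi (n : ℕ) :
    complexGaussian n = (Measure.pi fun _ : Fin n => complexNormal).map (toLp 2) := by
  have h := (measurePreserving_arrowProdEquivProdArrow ℝ ℝ (Fin n)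
    (fun _ => gaussianReal 0 (1 / 2 : ℝ≥0)) (fun _ => gaussianReal 0 (1 / 2 : ℝ≥0)))
  have h2 := measurePreserving_pi (ι := Fin n)
    (fun _ => (gaussianReal 0 (1 / 2 : ℝ≥0)).prod (gaussianReal 0 (1 / 2 : ℝ≥0)))
    (fun _ => complexNormal) (f := fun _ p => (⟨p.1, p.2⟩ : ℂ))
    (fun _ => ⟨measurable_complex_mk, rfl⟩)
  rw [complexGaussian, ← h.map_eq, Measure.map_map (measurable_toLp_complex_mk n) h.measurable,
    ← h2.map_eq, Measure.map_map (PiLp.continuous_toLp 2 _).measurable h2.measurable]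
  rfl

/-- The characteristic function depends on `‖t‖` only: the law `complexGaussian n` is isotropic.
The real inner product on `EuclideanSpace ℂ (Fin n)` is the one of `PiLp` over the real inner
product space `ℂ`. -/
lemma charFun_complexGaussian {n : ℕ} (t : EuclideanSpace ℂ (Fin n)) :
    charFun (complexGaussian n) t = Complex.exp (-(‖t‖ ^ 2 / 4 : ℝ)) := by
  rw [complexGaussian_eq_map_pi, charFun_pi]
  simp_rw [charFun_complexNormal]
  rw [← Complex.exp_sum, EuclideanSpace.norm_sq_eq, Finset.sum_div]
  push_cast
  rw [Finset.sum_neg_distrib]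

lemma inner_real_eq_re {n : ℕ} (x y : EuclideanSpace ℂ (Fin n)) :
    inner ℝ x y = (inner ℂ x y).re := by
  rw [PiLp.inner_apply, PiLp.inner_apply, Complex.re_sum]
  refine Finset.sum_congr rfl fun i _ => ?_
  rw [Complex.inner, RCLike.inner_apply, mul_comm]

lemma charFun_map_inner {n : ℕ} (v : EuclideanSpace ℂ (Fin n)) (t : ℂ) :
    charFun ((complexGaussian n).map fun a => inner ℂ v a) t =
      Complex.exp (-(‖v‖ ^ 2 * ‖t‖ ^ 2 / 4 : ℝ)) := by
  have h (a : EuclideanSpace ℂ (Fin n)) : inner ℝ (inner ℂ v a) t = inner ℝ a (t • v) := by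
    rw [inner_real_eq_re, inner_smul_right, Complex.inner, inner_conj_symm, mul_comm]
  rw [charFun_apply, integral_map (by fun_prop) (by fun_prop)]
  simp_rw [h]
  rw [← charFun_apply, charFun_complexGaussian, norm_smul]
  congr 4
  ring

lemma map_inner_complexGaussian {n : ℕ} (v : EuclideanSpace ℂ (Fin n)) :
    (complexGaussian n).map (fun a => inner ℂ v a) = complexNormal.map (‖v‖ • ·) := by
  have := Measure.isProbabilityMeasure_map (μ := complexGaussian n)
    (f := fun a => inner ℂ v a) (by fun_prop)
  have := Measure.isProbabilityMeasure_map (μ := complexNormal)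
    (f := fun z => ‖v‖ • z) (by fun_prop)
  refine Measure.ext_of_charFun (funext fun t => ?_)
  rw [charFun_map_inner, charFun_map_smul, charFun_complexNormal, norm_smul, norm_norm, mul_pow]

lemma map_inner_complexGaussian_of_norm_eq_one {n : ℕ} {v : EuclideanSpace ℂ (Fin n)}
    (hv : ‖v‖ = 1) : (complexGaussian n).map (fun a => inner ℂ v a) = complexNormal := by
  rw [map_inner_complexGaussian, hv]
  simp

/-- Components of a complex Gaussian vector along orthogonal directions are independent: the joint
characteristic function splits by the Pythagorean theorem. -/
lemma indepFun_inner {n : ℕ} {v w : EuclideanSpace ℂ (Fin n)} (hvw : inner ℂ v w = 0) :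
    IndepFun (fun a => inner ℂ v a) (fun a => inner ℂ w a) (complexGaussian n) := by
  rw [indepFun_iff_charFun_prod (by fun_prop) (by fun_prop)]
  intro t
  have h (a : EuclideanSpace ℂ (Fin n)) :
      inner ℝ (toLp 2 (inner ℂ v a, inner ℂ w a) : WithLp 2 (ℂ × ℂ)) t =
        inner ℝ a (t.ofLp.1 • v + t.ofLp.2 • w) := by
    rw [inner_real_eq_re, inner_add_right, inner_smul_right, inner_smul_right,
      WithLp.prod_inner_apply, Complex.inner, Complex.inner]
    simp only [inner_conj_symm, Complex.add_re]
  rw [charFun_apply, integral_map (by fun_prop) (by fun_prop)]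
  simp_rw [h]
  rw [← charFun_apply, charFun_complexGaussian, charFun_map_inner, charFun_map_inner,
    ← Complex.exp_add]
  have h0 : inner ℂ (t.ofLp.1 • v) (t.ofLp.2 • w) = 0 := by
    rw [inner_smul_left, inner_smul_right, hvw, mul_zero, mul_zero]
  have h1 := norm_add_sq_eq_norm_sq_add_norm_sq_of_inner_eq_zero _ _ h0
  rw [← sq, ← sq, ← sq] at h1
  rw [h1, norm_smul, norm_smul]
  congr 1
  push_cast
  ring

/-! ### Dilations and moments of the standard complex Gaussian -/

/-- The substitution `x ↦ s x` under the Gaussian law, with the ratio of the two densities as a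
weight. -/
lemma lintegral_gaussianReal_scale {s : ℝ} (hs : 0 < s) {F : ℝ → ℝ≥0∞} (hF : Measurable F) :
    ∫⁻ x, F x ∂gaussianReal 0 (1 / 2 : ℝ≥0) =
      ∫⁻ x, ENNReal.ofReal (s * Real.exp ((1 - s ^ 2) * x ^ 2)) * F (s * x)
        ∂gaussianReal 0 (1 / 2 : ℝ≥0) := by
  have hv : (1 / 2 : ℝ≥0) ≠ 0 := by norm_num
  rw [gaussianReal_of_var_ne_zero 0 hv,
    lintegral_withDensity_eq_lintegral_mul _ (measurable_gaussianPDF _ _) hF,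
    lintegral_withDensity_eq_lintegral_mul _ (measurable_gaussianPDF _ _) (by fun_prop)]
  conv_lhs => rw [← Real.smul_map_volume_mul_left hs.ne']
  rw [lintegral_smul_measure, lintegral_map (by fun_prop) (by fun_prop), smul_eq_mul,
    ← lintegral_const_mul _ (by fun_prop)]
  refine lintegral_congr fun x => ?_
  simp only [Pi.mul_apply, gaussianPDF]
  rw [← mul_assoc, ← mul_assoc, ← ENNReal.ofReal_mul (abs_nonneg _), ← ENNReal.ofReal_mul
    (gaussianPDFReal_nonneg _ _ _), abs_of_pos hs, gaussianPDFReal, gaussianPDFReal]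
  congr 2
  have : -(s * x - 0) ^ 2 / (2 * ((1 / 2 : ℝ≥0) : ℝ)) =
      -(x - 0) ^ 2 / (2 * ((1 / 2 : ℝ≥0) : ℝ)) + (1 - s ^ 2) * x ^ 2 := by
    push_cast
    ring
  rw [this, Real.exp_add]
  ring

/-- Weighted changes of variables in two measure spaces combine to one in their product. -/
lemma lintegral_prod_scale {α β : Type*} [MeasurableSpace α] [MeasurableSpace β]
    {μ : Measure α} {ν : Measure β} [SFinite μ] [SFinite ν] {S : α → α} {T : β → β}
    {ρ : α → ℝ≥0∞} {σ : β → ℝ≥0∞} (hS : Measurable S) (hT : Measurable T)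
    (hρ : Measurable ρ) (hσ : Measurable σ)
    (hμ : ∀ F : α → ℝ≥0∞, Measurable F → ∫⁻ x, F x ∂μ = ∫⁻ x, ρ x * F (S x) ∂μ)
    (hν : ∀ F : β → ℝ≥0∞, Measurable F → ∫⁻ x, F x ∂ν = ∫⁻ x, σ x * F (T x) ∂ν)
    {F : α × β → ℝ≥0∞} (hF : Measurable F) :
    ∫⁻ p, F p ∂μ.prod ν = ∫⁻ p, ρ p.1 * σ p.2 * F (S p.1, T p.2) ∂μ.prod ν := by
  rw [lintegral_prod _ hF.aemeasurable, lintegral_prod _ (by fun_prop), hμ _ (by fun_prop)]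
  refine lintegral_congr fun x => ?_
  rw [hν _ (by fun_prop), ← lintegral_const_mul _ (by fun_prop)]
  simp only [mul_assoc]

lemma lintegral_complexNormal_scale {s : ℝ} (hs : 0 < s) {F : ℂ → ℝ≥0∞} (hF : Measurable F) :
    ∫⁻ z, F z ∂complexNormal =
      ∫⁻ z, ENNReal.ofReal (s ^ 2 * Real.exp ((1 - s ^ 2) * ‖z‖ ^ 2)) * F (s • z)
        ∂complexNormal := by
  have hm := measurable_complex_mk
  rw [complexNormal, lintegral_map hF hm, lintegral_map (by fun_prop) hm,
    lintegral_prod_scale (S := fun x => s * x) (T := fun x => s * x) (by fun_prop) (by fun_prop)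
      (by fun_prop) (by fun_prop) (fun F hF => lintegral_gaussianReal_scale hs hF)
      (fun F hF => lintegral_gaussianReal_scale hs hF)
      (F := fun p : ℝ × ℝ => F (⟨p.1, p.2⟩ : ℂ)) (hF.comp hm)]
  refine lintegral_congr fun p => ?_
  rw [← ENNReal.ofReal_mul (by positivity), Complex.sq_norm, Complex.normSq_apply]
  congr 2
  · have : (1 - s ^ 2) * (p.1 * p.1 + p.2 * p.2) =
      (1 - s ^ 2) * p.1 ^ 2 + (1 - s ^ 2) * p.2 ^ 2 := by ring
    simp only [this, Real.exp_add]
    ring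
  · apply Complex.ext <;> simp

lemma lintegral_complexNormal_prod_scale {s : ℝ} (hs : 0 < s) {F : ℂ × ℂ → ℝ≥0∞}
    (hF : Measurable F) :
    ∫⁻ p, F p ∂complexNormal.prod complexNormal =
      ∫⁻ p, ENNReal.ofReal (s ^ 4 * Real.exp ((1 - s ^ 2) * (‖p.1‖ ^ 2 + ‖p.2‖ ^ 2))) *
        F (s • p) ∂complexNormal.prod complexNormal := by
  rw [lintegral_prod_scale (S := fun x => s • x) (T := fun x => s • x) (by fun_prop)
      (by fun_prop) (by fun_prop) (by fun_prop)
      (fun F hF => lintegral_complexNormal_scale hs hF)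
      (fun F hF => lintegral_complexNormal_scale hs hF) hF]
  refine lintegral_congr fun p => ?_
  rw [← ENNReal.ofReal_mul (by positivity), mul_add, Real.exp_add]
  congr 2
  ring

/-- The constant function in the scaling identity, with `s² = 1/2`, evaluates the exponential
moment. -/
lemma lintegral_exp_complexNormal :
    ∫⁻ z, ENNReal.ofReal (Real.exp (‖z‖ ^ 2 / 2)) ∂complexNormal = 2 := by
  have h := lintegral_complexNormal_scale (s := √(1 / 2)) (by positivity)
    (F := fun _ => 1) (by fun_prop)
  simp only [mul_one, lintegral_const, measure_univ,
    Real.sq_sqrt (show (0 : ℝ) ≤ 1 / 2 by norm_num)] at h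
  have h1 (z : ℂ) : ENNReal.ofReal (Real.exp (‖z‖ ^ 2 / 2)) =
      2 * ENNReal.ofReal (1 / 2 * Real.exp ((1 - 1 / 2) * ‖z‖ ^ 2)) := by
    rw [show (2 : ℝ≥0∞) = ENNReal.ofReal 2 by simp, ← ENNReal.ofReal_mul (by norm_num)]
    congr 1
    ring_nf
  simp_rw [h1]
  rw [lintegral_const_mul _ (by fun_prop), ← h, mul_one]

lemma integrable_exp_complexNormal :
    Integrable (fun z : ℂ => Real.exp (‖z‖ ^ 2 / 2)) complexNormal := by
  refine ⟨by fun_prop, ?_⟩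
  rw [hasFiniteIntegral_iff_ofReal (ae_of_all _ fun _ => (Real.exp_pos _).le),
    lintegral_exp_complexNormal]
  simp

lemma integral_exp_complexNormal : ∫ z : ℂ, Real.exp (‖z‖ ^ 2 / 2) ∂complexNormal = 2 := by
  rw [integral_eq_lintegral_of_nonneg_ae (ae_of_all _ fun _ => (Real.exp_pos _).le) (by fun_prop),
    lintegral_exp_complexNormal]
  simp

lemma integrable_norm_sq_complexNormal : Integrable (fun z : ℂ => ‖z‖ ^ 2) complexNormal := by
  refine (integrable_exp_complexNormal.const_mul 2).mono' (by fun_prop) (ae_of_all _ fun z => ?_)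
  rw [Real.norm_of_nonneg (by positivity)]
  linarith [Real.add_one_le_exp (‖z‖ ^ 2 / 2)]

lemma integral_comp_re_im (f : ℝ × ℝ → ℝ) (hf : Continuous f) :
    ∫ z : ℂ, f (z.re, z.im) ∂complexNormal =
      ∫ p, f p ∂(gaussianReal 0 (1 / 2 : ℝ≥0)).prod (gaussianReal 0 (1 / 2 : ℝ≥0)) := by
  rw [complexNormal, integral_map measurable_complex_mk.aemeasurable
    (by exact (by fun_prop : Continuous fun z : ℂ => f (z.re, z.im)).aestronglyMeasurable)]

lemma integral_re_complexNormal : ∫ z : ℂ, z.re ∂complexNormal = 0 := by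
  rw [integral_comp_re_im (fun p => p.1) continuous_fst, integral_fun_fst (fun x : ℝ => x)]
  simp

lemma integral_im_complexNormal : ∫ z : ℂ, z.im ∂complexNormal = 0 := by
  rw [integral_comp_re_im (fun p => p.2) continuous_snd, integral_fun_snd (fun x : ℝ => x)]
  simp

lemma integral_sq_gaussianReal : ∫ x : ℝ, x ^ 2 ∂gaussianReal 0 (1 / 2 : ℝ≥0) = 1 / 2 := by
  have h := variance_id_gaussianReal (μ := 0) (v := 1 / 2)
  rw [variance_of_integral_eq_zero (by fun_prop) (by simp)] at h
  simpa using h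

lemma integral_norm_sq_complexNormal : ∫ z : ℂ, ‖z‖ ^ 2 ∂complexNormal = 1 := by
  have hi : Integrable (fun x : ℝ => x ^ 2) (gaussianReal 0 (1 / 2 : ℝ≥0)) :=
    (memLp_id_gaussianReal 2).integrable_sq
  have h (z : ℂ) : ‖z‖ ^ 2 = z.re ^ 2 + z.im ^ 2 := by
    rw [Complex.sq_norm, Complex.normSq_apply]; ring
  simp_rw [h]
  rw [integral_comp_re_im (fun p => p.1 ^ 2 + p.2 ^ 2) (by fun_prop), integral_add,
    integral_fun_fst (fun x : ℝ => x ^ 2), integral_fun_snd (fun x : ℝ => x ^ 2),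
    integral_sq_gaussianReal]
  · simp
    norm_num
  · exact hi.comp_fst _
  · exact hi.comp_snd _

/-! ### The spectral gap of the mean -/

/-- The mean `𝔼|b¹ - b²|` of the quadratic form of a pair in the direction `x₀`; the pair of
Gaussians `⟨x₀, a¹⟩`, `⟨x₀, a²⟩` has squared norms `b¹`, `b²`. -/
noncomputable def meanAlong : ℝ :=
  ∫ p, |‖p.1‖ ^ 2 - ‖p.2‖ ^ 2| ∂complexNormal.prod complexNormal

/-- The mean `𝔼[|b¹ - b²| / (b¹ + b²)]` of the quadratic form of a pair in any unit direction
orthogonal to `x₀`. -/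
noncomputable def meanAcross : ℝ :=
  ∫ p, |‖p.1‖ ^ 2 - ‖p.2‖ ^ 2| / (‖p.1‖ ^ 2 + ‖p.2‖ ^ 2) ∂complexNormal.prod complexNormal

lemma abs_sub_div_add_le_one {b c : ℝ} (hb : 0 ≤ b) (hc : 0 ≤ c) : |b - c| / (b + c) ≤ 1 := by
  refine div_le_one_of_le₀ (abs_le.2 ⟨?_, ?_⟩) (by positivity) <;> linarith

lemma integrable_abs_sub : Integrable (fun p : ℂ × ℂ => |‖p.1‖ ^ 2 - ‖p.2‖ ^ 2|)
    (complexNormal.prod complexNormal) :=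
  ((integrable_norm_sq_complexNormal.comp_fst _).sub
    (integrable_norm_sq_complexNormal.comp_snd _)).abs

lemma measurable_ratio :
    Measurable (fun p : ℂ × ℂ => |‖p.1‖ ^ 2 - ‖p.2‖ ^ 2| / (‖p.1‖ ^ 2 + ‖p.2‖ ^ 2)) :=
  Measurable.div (by fun_prop) (by fun_prop)

lemma integrable_ratio :
    Integrable (fun p : ℂ × ℂ => |‖p.1‖ ^ 2 - ‖p.2‖ ^ 2| / (‖p.1‖ ^ 2 + ‖p.2‖ ^ 2))
      (complexNormal.prod complexNormal) := by
  refine (integrable_const (1 : ℝ)).mono' measurable_ratio.aestronglyMeasurable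
    (ae_of_all _ fun p => ?_)
  rw [Real.norm_of_nonneg (by positivity)]
  exact abs_sub_div_add_le_one (by positivity) (by positivity)

/-- The ratio `h = |b¹ - b²| / (b¹ + b²)` does not change under scaling, so substituting
`p ↦ s p` gives `𝔼 h = s⁴ 𝔼[h exp (-(s² - 1) r)]` with `r = b¹ + b²`; the bound
`exp (-y) ≥ 1 - y` and `h r = |b¹ - b²|` then compare the two means. -/
lemma meanAcross_le : 3 / 2 * meanAcross ≤ meanAlong := by
  set μ := complexNormal.prod complexNormal with hμ
  have hm := measurable_ratio
  -- With `s = 11/10` the comparison constant `(s² + 1) / s⁴` exceeds `3/2`.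
  have hs : (0 : ℝ) < 11 / 10 := by norm_num
  have key : meanAcross = ∫ p : ℂ × ℂ, (11 / 10) ^ 4 *
      Real.exp ((1 - (11 / 10) ^ 2) * (‖p.1‖ ^ 2 + ‖p.2‖ ^ 2)) *
      (|‖p.1‖ ^ 2 - ‖p.2‖ ^ 2| / (‖p.1‖ ^ 2 + ‖p.2‖ ^ 2)) ∂μ := by
    rw [meanAcross, integral_eq_lintegral_of_nonneg_ae (ae_of_all _ fun _ => by positivity)
      hm.aestronglyMeasurable,
      integral_eq_lintegral_of_nonneg_ae (ae_of_all _ fun _ => by positivity)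
      (by exact (Measurable.mul (by fun_prop) hm).aestronglyMeasurable),
      lintegral_complexNormal_prod_scale hs hm.ennreal_ofReal]
    congr 1
    refine lintegral_congr fun p => ?_
    rw [← ENNReal.ofReal_mul (by positivity)]
    congr 2
    rw [Prod.smul_fst, Prod.smul_snd, norm_smul, norm_smul, Real.norm_of_nonneg hs.le, mul_pow,
      mul_pow, ← mul_sub, ← mul_add, abs_mul, abs_of_pos (by positivity),
      mul_div_mul_left _ _ (by positivity)]
  have h1 : ∫ p : ℂ × ℂ, (11 / 10) ^ 4 *
      (|‖p.1‖ ^ 2 - ‖p.2‖ ^ 2| / (‖p.1‖ ^ 2 + ‖p.2‖ ^ 2)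
        - ((11 / 10) ^ 2 - 1) * |‖p.1‖ ^ 2 - ‖p.2‖ ^ 2|) ∂μ ≤ meanAcross := by
    rw [key]
    refine integral_mono (((integrable_ratio.sub (integrable_abs_sub.const_mul _))).const_mul _)
      ?_ fun p => ?_
    · refine (integrable_const (((11 : ℝ) / 10) ^ 4)).mono'
        (Measurable.mul (by fun_prop) hm).aestronglyMeasurable (ae_of_all _ fun p => ?_)
      rw [Real.norm_of_nonneg (by positivity), mul_assoc]
      refine mul_le_of_le_one_right (by positivity) (mul_le_one₀ (Real.exp_le_one_iff.2 ?_)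
        (by positivity) (abs_sub_div_add_le_one (by positivity) (by positivity)))
      refine mul_nonpos_of_nonpos_of_nonneg (by norm_num) (by positivity)
    · set r := ‖p.1‖ ^ 2 + ‖p.2‖ ^ 2 with hr
      set d := |‖p.1‖ ^ 2 - ‖p.2‖ ^ 2| with hd
      have hd0 : 0 ≤ d := abs_nonneg _
      have hr0 : 0 ≤ r := by positivity
      have hdr : d / r * r = d := by
        refine div_mul_cancel_of_imp fun h => ?_
        have h1 : ‖p.1‖ ^ 2 = 0 := by nlinarith [sq_nonneg ‖p.1‖, sq_nonneg ‖p.2‖]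
        have h2 : ‖p.2‖ ^ 2 = 0 := by nlinarith [sq_nonneg ‖p.1‖, sq_nonneg ‖p.2‖]
        rw [hd, h1, h2]
        simp
      have he := mul_le_mul_of_nonneg_left
        (Real.add_one_le_exp ((1 - (11 / 10) ^ 2) * r)) (div_nonneg hd0 hr0)
      have h3 : d / r - ((11 / 10) ^ 2 - 1) * d ≤
          Real.exp ((1 - (11 / 10) ^ 2) * r) * (d / r) := by
        calc d / r - ((11 / 10) ^ 2 - 1) * d
            = d / r - ((11 / 10) ^ 2 - 1) * (d / r * r) := by rw [hdr]
          _ = d / r * ((1 - (11 / 10) ^ 2) * r + 1) := by ring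
          _ ≤ _ := by rw [mul_comm (Real.exp _)]; exact he
      simp only [mul_assoc]
      exact mul_le_mul_of_nonneg_left h3 (by positivity)
  rw [integral_const_mul, integral_sub integrable_ratio (integrable_abs_sub.const_mul _),
    integral_const_mul] at h1
  change (11 / 10) ^ 4 * (meanAcross - ((11 / 10) ^ 2 - 1) * meanAlong) ≤ meanAcross at h1
  have h0 : 0 ≤ meanAcross := integral_nonneg fun _ => by positivity
  linarith

lemma ae_norm_sq_ne (c : ℝ) : ∀ᵐ z ∂complexNormal, ‖z‖ ^ 2 ≠ c := by
  have := nullSingletonClass_gaussianReal (μ := 0) (v := 1 / 2) (by norm_num)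
  have hm : MeasurableSet {z : ℂ | ‖z‖ ^ 2 ≠ c} :=
    (measurableSet_eq_fun (f := fun z : ℂ => ‖z‖ ^ 2) (by fun_prop) measurable_const).compl
  rw [complexNormal, ae_map_iff measurable_complex_mk.aemeasurable hm,
    Measure.ae_prod_iff_ae_ae (p := fun x : ℝ × ℝ => ‖(⟨x.1, x.2⟩ : ℂ)‖ ^ 2 ≠ c)
      (measurable_complex_mk hm)]
  refine ae_of_all _ fun x => ?_
  have hfin : {y : ℝ | y ^ 2 = c - x ^ 2}.Finite := by
    refine (Set.toFinite {√(c - x ^ 2), -√(c - x ^ 2)}).subset fun y hy => ?_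
    have hy : y ^ 2 = c - x ^ 2 := hy
    rw [← hy, Real.sqrt_sq_eq_abs]
    rcases abs_choice y with h | h <;> simp [h]
  filter_upwards [compl_mem_ae_iff.2 (hfin.measure_zero (gaussianReal 0 (1 / 2)))] with y hy hc
  refine hy ?_
  rw [Complex.sq_norm, Complex.normSq_apply] at hc
  change y ^ 2 = c - x ^ 2
  rw [← hc]
  ring

lemma meanAcross_pos : 0 < meanAcross := by
  refine lt_of_le_of_ne (integral_nonneg fun _ => by positivity) fun h0 => ?_
  have h1 := (integral_eq_zero_iff_of_nonneg (fun _ => by positivity) integrable_ratio).1 h0.symm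
  have h2 : ∀ᵐ p ∂complexNormal.prod complexNormal, ‖p.2‖ ^ 2 ≠ ‖p.1‖ ^ 2 := by
    have hm : MeasurableSet {p : ℂ × ℂ | ‖p.2‖ ^ 2 ≠ ‖p.1‖ ^ 2} :=
      (measurableSet_eq_fun (f := fun p : ℂ × ℂ => ‖p.2‖ ^ 2) (g := fun p => ‖p.1‖ ^ 2)
        (by fun_prop) (by fun_prop)).compl
    rw [Measure.ae_prod_iff_ae_ae hm]
    exact ae_of_all _ fun z => ae_norm_sq_ne (‖z‖ ^ 2)
  obtain ⟨p, hp1, hp2⟩ := (h1.and h2).exists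
  have hp1 : |‖p.1‖ ^ 2 - ‖p.2‖ ^ 2| / (‖p.1‖ ^ 2 + ‖p.2‖ ^ 2) = 0 := hp1
  rcases div_eq_zero_iff.1 hp1 with h | h
  · exact hp2 (sub_eq_zero.1 (abs_eq_zero.1 h)).symm
  · have h3 : ‖p.1‖ ^ 2 = 0 := by linarith [sq_nonneg ‖p.1‖, sq_nonneg ‖p.2‖]
    have h4 : ‖p.2‖ ^ 2 = 0 := by linarith [sq_nonneg ‖p.1‖, sq_nonneg ‖p.2‖]
    exact hp2 (h4.trans h3.symm)

/-- The spectral gap of the mean matrix. -/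
lemma meanAcross_lt_meanAlong : meanAcross < meanAlong := by
  linarith [meanAcross_le, meanAcross_pos]

/-! ### Second moments of projections weighted by the component along a vector -/

section

variable {n : ℕ}

lemma intensity_eq (u a : EuclideanSpace ℂ (Fin n)) : intensity u a = ‖inner ℂ u a‖ ^ 2 := by
  rw [intensity, norm_inner_symm]

lemma intensity_nonneg (u a : EuclideanSpace ℂ (Fin n)) : 0 ≤ intensity u a := sq_nonneg _

lemma measurable_intensity (u : EuclideanSpace ℂ (Fin n)) : Measurable (intensity u) := by
  unfold intensity
  fun_prop

lemma integral_comp_inner {E : Type*} [NormedAddCommGroup E] [NormedSpace ℝ E]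
    {v : EuclideanSpace ℂ (Fin n)} (hv : ‖v‖ = 1) {f : ℂ → E}
    (hf : AEStronglyMeasurable f complexNormal) :
    ∫ a, f (inner ℂ v a) ∂complexGaussian n = ∫ z, f z ∂complexNormal := by
  rw [← map_inner_complexGaussian_of_norm_eq_one hv] at hf ⊢
  rw [integral_map (by fun_prop) hf]

lemma integrable_comp_inner {v : EuclideanSpace ℂ (Fin n)} (hv : ‖v‖ = 1) {f : ℂ → ℝ}
    (hf : Integrable f complexNormal) :
    Integrable (fun a => f (inner ℂ v a)) (complexGaussian n) := by
  rw [← map_inner_complexGaussian_of_norm_eq_one hv] at hf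
  exact hf.comp_measurable (by fun_prop)

lemma integral_comp_inner_eq_smul (v : EuclideanSpace ℂ (Fin n)) {f : ℂ → ℝ} (hf : Continuous f) :
    ∫ a, f (inner ℂ v a) ∂complexGaussian n = ∫ z, f (‖v‖ • z) ∂complexNormal := by
  have h := map_inner_complexGaussian v
  have h1 := integral_map (μ := complexGaussian n) (φ := fun a => inner ℂ v a) (f := f)
    (by fun_prop) hf.aestronglyMeasurable
  rw [← h1, h, integral_map (by fun_prop) hf.aestronglyMeasurable]

lemma integrable_intensity (v : EuclideanSpace ℂ (Fin n)) :
    Integrable (intensity v) (complexGaussian n) := by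
  have h : Integrable (fun z : ℂ => ‖z‖ ^ 2) ((complexGaussian n).map fun a => inner ℂ v a) := by
    rw [map_inner_complexGaussian, integrable_map_measure (by fun_prop) (by fun_prop)]
    simp only [Function.comp_def, norm_smul, norm_norm, mul_pow]
    exact integrable_norm_sq_complexNormal.const_mul _
  convert h.comp_measurable (by fun_prop) using 1
  ext a
  exact intensity_eq v a

lemma integral_intensity (v : EuclideanSpace ℂ (Fin n)) :
    ∫ a, intensity v a ∂complexGaussian n = ‖v‖ ^ 2 := by
  simp_rw [intensity_eq]
  rw [integral_comp_inner_eq_smul v (f := fun z => ‖z‖ ^ 2) (by fun_prop)]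
  simp only [norm_smul, norm_norm, mul_pow]
  rw [integral_const_mul, integral_norm_sq_complexNormal, mul_one]

lemma norm_add_sq_complex (v y : ℂ) :
    ‖v + y‖ ^ 2 = ‖v‖ ^ 2 + ‖y‖ ^ 2 + 2 * (v.re * y.re) + 2 * (v.im * y.im) := by
  simp only [Complex.sq_norm, Complex.normSq_apply, Complex.add_re, Complex.add_im]
  ring

/-- Given the component of a Gaussian vector along `x₀`, the mean square of its component along `u`
is `τ² |z|² + (1 - τ²)`, where `τ = |⟨x₀, u⟩|` and `z` is the given component: decompose `u` into
its part along `x₀` and its part `w` orthogonal to `x₀`; the two components are independent and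
the cross terms have mean zero. -/
lemma integral_mul_intensity {x₀ u : EuclideanSpace ℂ (Fin n)} (hx : ‖x₀‖ = 1) (hu : ‖u‖ = 1)
    {f : ℂ → ℝ} (hf : Measurable f) (hf1 : ∀ z, |f z| ≤ 1) :
    ∫ a, f (inner ℂ x₀ a) * intensity u a ∂complexGaussian n =
      ∫ z, f z * (‖inner ℂ x₀ u‖ ^ 2 * ‖z‖ ^ 2 + (1 - ‖inner ℂ x₀ u‖ ^ 2)) ∂complexNormal := by
  set c : ℂ := inner ℂ x₀ u with hc
  set w : EuclideanSpace ℂ (Fin n) := u - c • x₀ with hw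
  have hxw : inner ℂ x₀ w = 0 := by
    rw [hw, inner_sub_right, inner_smul_right, inner_self_eq_norm_sq_to_K, hx, ← hc]
    simp
  have hwn : ‖w‖ ^ 2 = 1 - ‖c‖ ^ 2 := by
    have h0 : inner ℂ (c • x₀) w = 0 := by rw [inner_smul_left, hxw, mul_zero]
    have h1 := norm_add_sq_eq_norm_sq_add_norm_sq_of_inner_eq_zero _ _ h0
    rw [hw, add_sub_cancel, hu, norm_smul, hx, ← hw] at h1
    linarith
  have hind := indepFun_inner hxw
  set X : EuclideanSpace ℂ (Fin n) → ℂ := fun a => inner ℂ x₀ a with hX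
  set Y : EuclideanSpace ℂ (Fin n) → ℂ := fun a => inner ℂ w a with hY
  have hXm : Measurable X := by fun_prop
  have hYm : Measurable Y := by fun_prop
  have hXi : Integrable (fun a => ‖X a‖ ^ 2) (complexGaussian n) :=
    (integrable_intensity x₀).congr (ae_of_all _ (intensity_eq x₀))
  have hYi : Integrable (fun a => ‖Y a‖ ^ 2) (complexGaussian n) :=
    (integrable_intensity w).congr (ae_of_all _ (intensity_eq w))
  have hsplit (a) : f (X a) * intensity u a = f (X a) * (‖c‖ ^ 2 * ‖X a‖ ^ 2) +
      f (X a) * ‖Y a‖ ^ 2 + 2 * ((f (X a) * (starRingEnd ℂ c * X a).re) * (Y a).re) +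
        2 * ((f (X a) * (starRingEnd ℂ c * X a).im) * (Y a).im) := by
    have hu' : inner ℂ u a = starRingEnd ℂ c * X a + Y a := by
      rw [hX, hY, ← inner_smul_left, ← inner_add_left, hw, add_sub_cancel]
    rw [intensity_eq, hu', norm_add_sq_complex, norm_mul, RCLike.norm_conj, mul_pow]
    ring
  have hdom : Integrable (fun a => ‖c‖ ^ 2 * ‖X a‖ ^ 2 + ‖Y a‖ ^ 2) (complexGaussian n) :=
    (hXi.const_mul _).add hYi
  have hmul {x y : ℝ} (hx : |x| ≤ 1) : |x * y| ≤ |y| := by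
    rw [abs_mul]; exact mul_le_of_le_one_left (abs_nonneg _) hx
  have i1 : Integrable (fun a => f (X a) * (‖c‖ ^ 2 * ‖X a‖ ^ 2)) (complexGaussian n) := by
    refine (hXi.const_mul (‖c‖ ^ 2)).mono' (by fun_prop) (ae_of_all _ fun a => ?_)
    refine (hmul (hf1 _)).trans_eq (abs_of_nonneg (by positivity))
  have i2 : Integrable (fun a => f (X a) * ‖Y a‖ ^ 2) (complexGaussian n) := by
    refine hYi.mono' (by fun_prop) (ae_of_all _ fun a => ?_)
    refine (hmul (hf1 _)).trans_eq (abs_of_nonneg (by positivity))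
  have hcross {p q : ℝ} {v y : ℂ} (z : ℂ) (hp : |p| ≤ ‖v‖) (hq : |q| ≤ ‖y‖) :
      ‖f z * p * q‖ ≤ ‖v‖ ^ 2 + ‖y‖ ^ 2 := by
    rw [mul_assoc, Real.norm_eq_abs]
    refine (hmul (hf1 _)).trans ?_
    rw [abs_mul]
    nlinarith [mul_le_mul hp hq (abs_nonneg _) (norm_nonneg _), sq_nonneg (‖v‖ - ‖y‖),
      sq_nonneg (‖v‖ + ‖y‖)]
  have hV (a) : ‖starRingEnd ℂ c * X a‖ ^ 2 = ‖c‖ ^ 2 * ‖X a‖ ^ 2 := by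
    rw [norm_mul, RCLike.norm_conj, mul_pow]
  have i3 : Integrable (fun a => f (X a) * (starRingEnd ℂ c * X a).re * (Y a).re)
      (complexGaussian n) := by
    refine hdom.mono' (by fun_prop) (ae_of_all _ fun a => ?_)
    rw [← hV]
    exact hcross _ (Complex.abs_re_le_norm _) (Complex.abs_re_le_norm _)
  have i4 : Integrable (fun a => f (X a) * (starRingEnd ℂ c * X a).im * (Y a).im)
      (complexGaussian n) := by
    refine hdom.mono' (by fun_prop) (ae_of_all _ fun a => ?_)
    rw [← hV]
    exact hcross _ (Complex.abs_im_le_norm _) (Complex.abs_im_le_norm _)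
  have e2 : ∫ a, f (X a) * ‖Y a‖ ^ 2 ∂complexGaussian n =
      (∫ z, f z ∂complexNormal) * (1 - ‖c‖ ^ 2) := by
    rw [hind.integral_fun_comp_mul_comp (f := f) (g := fun y => ‖y‖ ^ 2) (by fun_prop)
      (by fun_prop) (by fun_prop) (by fun_prop), ← hwn, ← integral_intensity w,
      integral_comp_inner hx (by fun_prop)]
    simp_rw [intensity_eq]
    rfl
  have e3 : ∫ a, f (X a) * (starRingEnd ℂ c * X a).re * (Y a).re ∂complexGaussian n = 0 := by
    rw [hind.integral_fun_comp_mul_comp (f := fun z => f z * (starRingEnd ℂ c * z).re)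
      (g := fun y => y.re) (by fun_prop) (by fun_prop) (by fun_prop) (by fun_prop),
      integral_comp_inner_eq_smul w (f := fun z => z.re) Complex.continuous_re]
    simp only [Complex.smul_re, smul_eq_mul]
    rw [integral_const_mul, integral_re_complexNormal, mul_zero, mul_zero]
  have e4 : ∫ a, f (X a) * (starRingEnd ℂ c * X a).im * (Y a).im ∂complexGaussian n = 0 := by
    rw [hind.integral_fun_comp_mul_comp (f := fun z => f z * (starRingEnd ℂ c * z).im)
      (g := fun y => y.im) (by fun_prop) (by fun_prop) (by fun_prop) (by fun_prop),
      integral_comp_inner_eq_smul w (f := fun z => z.im) Complex.continuous_im]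
    simp only [Complex.smul_im, smul_eq_mul]
    rw [integral_const_mul, integral_im_complexNormal, mul_zero, mul_zero]
  refine (integral_congr_ae (ae_of_all _ hsplit)).trans ?_
  have i12 : Integrable (fun a => f (X a) * (‖c‖ ^ 2 * ‖X a‖ ^ 2) + f (X a) * ‖Y a‖ ^ 2)
    (complexGaussian n) := i1.add i2
  have i123 : Integrable (fun a => f (X a) * (‖c‖ ^ 2 * ‖X a‖ ^ 2) + f (X a) * ‖Y a‖ ^ 2 +
    2 * (f (X a) * (starRingEnd ℂ c * X a).re * (Y a).re)) (complexGaussian n) :=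
    i12.add (i3.const_mul 2)
  rw [integral_add i123 (i4.const_mul 2), integral_add i12 (i3.const_mul 2), integral_add i1 i2,
    integral_const_mul,
    integral_const_mul, e2, e3, e4,
    integral_comp_inner hx (f := fun z => f z * (‖c‖ ^ 2 * ‖z‖ ^ 2)) (by fun_prop),
    ← integral_mul_const, mul_zero, add_zero, add_zero, ← integral_add]
  · simp only [mul_add]
  · refine (integrable_norm_sq_complexNormal.const_mul (‖c‖ ^ 2)).mono' (by fun_prop)
      (ae_of_all _ fun a => (hmul (hf1 _)).trans_eq (abs_of_nonneg (by positivity)))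
  · refine Integrable.mul_const ((integrable_const (1 : ℝ)).mono' (by fun_prop)
      (ae_of_all _ fun a => hf1 a)) _

lemma integral_mul_intensity_fst {x₀ u : EuclideanSpace ℂ (Fin n)} (hx : ‖x₀‖ = 1) (hu : ‖u‖ = 1)
    {k : ℂ × ℂ → ℝ} (hk : Measurable k) (hk1 : ∀ p, |k p| ≤ 1) :
    ∫ q, k (inner ℂ x₀ q.1, inner ℂ x₀ q.2) * intensity u q.1
        ∂(complexGaussian n).prod (complexGaussian n) =
      ∫ p, k p * (‖inner ℂ x₀ u‖ ^ 2 * ‖p.1‖ ^ 2 + (1 - ‖inner ℂ x₀ u‖ ^ 2))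
        ∂complexNormal.prod complexNormal := by
  have hm := measurable_intensity u
  have hmul {x y : ℝ} (hx : |x| ≤ 1) : |x * y| ≤ |y| := by
    rw [abs_mul]; exact mul_le_of_le_one_left (abs_nonneg _) hx
  rw [integral_prod_symm, integral_prod_symm]
  · have h (b : EuclideanSpace ℂ (Fin n)) := integral_mul_intensity hx hu
      (f := fun z => k (z, inner ℂ x₀ b)) (by fun_prop) (fun z => hk1 _)
    simp only [h]
    refine integral_comp_inner hx (f := fun s => ∫ z, k (z, s) *
      (‖inner ℂ x₀ u‖ ^ 2 * ‖z‖ ^ 2 + (1 - ‖inner ℂ x₀ u‖ ^ 2)) ∂complexNormal) ?_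
    refine (StronglyMeasurable.integral_prod_left' (f := fun p : ℂ × ℂ => k p *
      (‖inner ℂ x₀ u‖ ^ 2 * ‖p.1‖ ^ 2 + (1 - ‖inner ℂ x₀ u‖ ^ 2))) ?_).aestronglyMeasurable
    exact (by fun_prop : Measurable _).stronglyMeasurable
  · refine Integrable.mono' (((integrable_norm_sq_complexNormal.const_mul _).add
      (integrable_const _)).comp_fst complexNormal).abs (by fun_prop)
      (ae_of_all _ fun p => hmul (hk1 p))
  · refine ((integrable_intensity u).comp_fst (complexGaussian n)).mono' (by fun_prop)
      (ae_of_all _ fun p => (hmul (hk1 _)).trans_eq (abs_of_nonneg (intensity_nonneg _ _)))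

lemma integral_mul_intensity_snd {x₀ u : EuclideanSpace ℂ (Fin n)} (hx : ‖x₀‖ = 1) (hu : ‖u‖ = 1)
    {k : ℂ × ℂ → ℝ} (hk : Measurable k) (hk1 : ∀ p, |k p| ≤ 1) :
    ∫ q, k (inner ℂ x₀ q.1, inner ℂ x₀ q.2) * intensity u q.2
        ∂(complexGaussian n).prod (complexGaussian n) =
      ∫ p, k p * (‖inner ℂ x₀ u‖ ^ 2 * ‖p.2‖ ^ 2 + (1 - ‖inner ℂ x₀ u‖ ^ 2))
        ∂complexNormal.prod complexNormal := by
  have h := integral_mul_intensity_fst hx hu (k := fun p => k p.swap) (by fun_prop)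
    (fun p => hk1 _)
  rw [← integral_prod_swap, ← integral_prod_swap (μ := complexNormal)]
  exact h

end

/-! ### The quadratic form of a pair of sensing vectors -/

section

variable {n : ℕ}

lemma quadForm_add (M N : Matrix (Fin n) (Fin n) ℂ) (u : EuclideanSpace ℂ (Fin n)) :
    quadForm (M + N) u = quadForm M u + quadForm N u := by
  simp [quadForm, Matrix.add_mulVec, dotProduct_add]

lemma quadForm_sub (M N : Matrix (Fin n) (Fin n) ℂ) (u : EuclideanSpace ℂ (Fin n)) :
    quadForm (M - N) u = quadForm M u - quadForm N u := by
  simp [quadForm, Matrix.sub_mulVec, dotProduct_sub]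

lemma quadForm_smul (c : ℝ) (M : Matrix (Fin n) (Fin n) ℂ) (u : EuclideanSpace ℂ (Fin n)) :
    quadForm (c • M) u = c * quadForm M u := by
  simp [quadForm, Matrix.smul_mulVec, dotProduct_smul]

lemma quadForm_sum {ι : Type*} (s : Finset ι) (M : ι → Matrix (Fin n) (Fin n) ℂ)
    (u : EuclideanSpace ℂ (Fin n)) :
    quadForm (∑ i ∈ s, M i) u = ∑ i ∈ s, quadForm (M i) u := by
  simp [quadForm, Matrix.sum_mulVec, dotProduct_sum]

lemma quadForm_outer (a u : EuclideanSpace ℂ (Fin n)) : quadForm (outer a) u = intensity u a := by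
  have h1 : inner ℂ a u = star a.ofLp ⬝ᵥ u.ofLp := by
    rw [EuclideanSpace.inner_eq_star_dotProduct, dotProduct_comm]
  have h2 : inner ℂ u a = star u.ofLp ⬝ᵥ a.ofLp := by
    rw [EuclideanSpace.inner_eq_star_dotProduct, dotProduct_comm]
  rw [quadForm, outer, Matrix.vecMulVec_mulVec, ← h1, dotProduct_smul, ← h2, intensity]
  simp only [MulOpposite.smul_eq_mul_unop, MulOpposite.unop_op]
  rw [← inner_conj_symm u a, mul_comm, Complex.mul_conj, Complex.ofReal_re,
    Complex.normSq_eq_norm_sq]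

lemma abs_bit (b c : ℝ) : |bit b c| = 1 := by
  unfold bit
  split_ifs <;> simp

lemma bit_mul_sub (b c : ℝ) : bit b c * (b - c) = |b - c| := by
  unfold bit
  split_ifs with h
  · rw [one_mul, abs_of_nonneg (sub_nonneg.2 h)]
  · rw [neg_one_mul, abs_of_neg (sub_neg.2 (not_le.1 h))]

lemma measurable_bit : Measurable fun p : ℝ × ℝ => bit p.1 p.2 :=
  Measurable.ite (measurableSet_le measurable_snd measurable_fst) measurable_const measurable_const

/-- The quadratic form of the contribution of a pair of sensing vectors, in the direction `u`. -/
noncomputable def pairForm (x₀ u : EuclideanSpace ℂ (Fin n))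
    (q : EuclideanSpace ℂ (Fin n) × EuclideanSpace ℂ (Fin n)) : ℝ :=
  quadForm (pairMatrix x₀ q.1 q.2) u

/-- The signed weight `y R¹`, as a function of `⟨x₀, a¹⟩` and `⟨x₀, a²⟩`. -/
noncomputable def weightFst (p : ℂ × ℂ) : ℝ :=
  bit (‖p.1‖ ^ 2) (‖p.2‖ ^ 2) * (‖p.1‖ ^ 2 / (‖p.1‖ ^ 2 + ‖p.2‖ ^ 2))

/-- The signed weight `y R²`, as a function of `⟨x₀, a¹⟩` and `⟨x₀, a²⟩`. -/
noncomputable def weightSnd (p : ℂ × ℂ) : ℝ :=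
  bit (‖p.1‖ ^ 2) (‖p.2‖ ^ 2) * (‖p.2‖ ^ 2 / (‖p.1‖ ^ 2 + ‖p.2‖ ^ 2))

lemma measurable_weightFst : Measurable weightFst :=
  (measurable_bit.comp (by fun_prop : Measurable fun p : ℂ × ℂ => (‖p.1‖ ^ 2, ‖p.2‖ ^ 2))).mul
    (Measurable.div (by fun_prop) (by fun_prop))

lemma measurable_weightSnd : Measurable weightSnd :=
  (measurable_bit.comp (by fun_prop : Measurable fun p : ℂ × ℂ => (‖p.1‖ ^ 2, ‖p.2‖ ^ 2))).mul
    (Measurable.div (by fun_prop) (by fun_prop))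

lemma abs_weightFst_le_one (p : ℂ × ℂ) : |weightFst p| ≤ 1 := by
  rw [weightFst, abs_mul, abs_bit, one_mul, abs_of_nonneg (by positivity)]
  exact div_le_one_of_le₀ (le_add_of_nonneg_right (by positivity)) (by positivity)

lemma abs_weightSnd_le_one (p : ℂ × ℂ) : |weightSnd p| ≤ 1 := by
  rw [weightSnd, abs_mul, abs_bit, one_mul, abs_of_nonneg (by positivity)]
  exact div_le_one_of_le₀ (le_add_of_nonneg_left (by positivity)) (by positivity)

lemma pairForm_eq (x₀ u : EuclideanSpace ℂ (Fin n))
    (q : EuclideanSpace ℂ (Fin n) × EuclideanSpace ℂ (Fin n)) :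
    pairForm x₀ u q = weightFst (inner ℂ x₀ q.1, inner ℂ x₀ q.2) * intensity u q.1 -
      weightSnd (inner ℂ x₀ q.1, inner ℂ x₀ q.2) * intensity u q.2 := by
  simp only [pairForm, pairMatrix]
  rw [quadForm_smul, quadForm_sub, quadForm_smul, quadForm_smul, quadForm_outer, quadForm_outer,
    intensity_eq x₀, intensity_eq x₀, weightFst, weightSnd]
  ring

lemma measurable_pairForm (x₀ u : EuclideanSpace ℂ (Fin n)) : Measurable (pairForm x₀ u) := by
  have h1 := measurable_weightFst
  have h2 := measurable_weightSnd
  have h3 := measurable_intensity u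
  simp only [funext (pairForm_eq x₀ u)]
  fun_prop

lemma abs_pairForm_le (x₀ u : EuclideanSpace ℂ (Fin n))
    (q : EuclideanSpace ℂ (Fin n) × EuclideanSpace ℂ (Fin n)) :
    |pairForm x₀ u q| ≤ intensity u q.1 + intensity u q.2 := by
  rw [pairForm_eq]
  refine (abs_sub _ _).trans (add_le_add ?_ ?_)
  · rw [abs_mul, abs_of_nonneg (intensity_nonneg u q.1)]
    exact mul_le_of_le_one_left (intensity_nonneg _ _) (abs_weightFst_le_one _)
  · rw [abs_mul, abs_of_nonneg (intensity_nonneg u q.2)]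
    exact mul_le_of_le_one_left (intensity_nonneg _ _) (abs_weightSnd_le_one _)

lemma integrable_exp_intensity {u : EuclideanSpace ℂ (Fin n)} (hu : ‖u‖ = 1) :
    Integrable (fun a => Real.exp (intensity u a / 2)) (complexGaussian n) := by
  simp_rw [intensity_eq]
  exact integrable_comp_inner hu integrable_exp_complexNormal

lemma integral_exp_intensity {u : EuclideanSpace ℂ (Fin n)} (hu : ‖u‖ = 1) :
    ∫ a, Real.exp (intensity u a / 2) ∂complexGaussian n = 2 := by
  simp_rw [intensity_eq]
  rw [integral_comp_inner hu (f := fun z => Real.exp (‖z‖ ^ 2 / 2)) (by fun_prop),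
    integral_exp_complexNormal]

lemma exp_abs_pairForm_le (x₀ u : EuclideanSpace ℂ (Fin n))
    (q : EuclideanSpace ℂ (Fin n) × EuclideanSpace ℂ (Fin n)) :
    Real.exp (|pairForm x₀ u q| / 2) ≤
      Real.exp (intensity u q.1 / 2) * Real.exp (intensity u q.2 / 2) := by
  rw [← Real.exp_add]
  exact Real.exp_le_exp.2 (by linarith [abs_pairForm_le x₀ u q])

lemma integrable_exp_abs_pairForm (x₀ : EuclideanSpace ℂ (Fin n)) {u : EuclideanSpace ℂ (Fin n)}
    (hu : ‖u‖ = 1) :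
    Integrable (fun q => Real.exp (|pairForm x₀ u q| / 2))
      ((complexGaussian n).prod (complexGaussian n)) := by
  have hm := measurable_pairForm x₀ u
  refine ((integrable_exp_intensity hu).mul_prod (integrable_exp_intensity hu)).mono'
    (Measurable.aestronglyMeasurable ?_) (ae_of_all _ fun q => ?_)
  · exact ((continuous_abs.measurable.comp hm).div_const 2).exp
  · rw [Real.norm_of_nonneg (Real.exp_pos _).le]
    exact exp_abs_pairForm_le _ _ _

lemma integral_exp_abs_pairForm_le (x₀ : EuclideanSpace ℂ (Fin n))
    {u : EuclideanSpace ℂ (Fin n)} (hu : ‖u‖ = 1) :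
    ∫ q, Real.exp (|pairForm x₀ u q| / 2) ∂(complexGaussian n).prod (complexGaussian n) ≤ 4 := by
  have h := integral_mono (integrable_exp_abs_pairForm x₀ hu)
    ((integrable_exp_intensity hu).mul_prod (integrable_exp_intensity hu))
    (exp_abs_pairForm_le x₀ u)
  refine h.trans_eq ?_
  rw [integral_prod_mul (fun a => Real.exp (intensity u a / 2))
    (fun a => Real.exp (intensity u a / 2)), integral_exp_intensity hu]
  norm_num

/-- The mean form is `meanAcross` on all of the space plus a spike along `x₀`. -/
lemma integral_pairForm {x₀ u : EuclideanSpace ℂ (Fin n)} (hx : ‖x₀‖ = 1) (hu : ‖u‖ = 1) :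
    ∫ q, pairForm x₀ u q ∂(complexGaussian n).prod (complexGaussian n) =
      meanAcross + (meanAlong - meanAcross) * intensity x₀ u := by
  have hm := measurable_intensity u
  have hw1 := measurable_weightFst
  have hw2 := measurable_weightSnd
  set t := ‖inner ℂ x₀ u‖ ^ 2 with ht
  have hmul {x y : ℝ} (hx : |x| ≤ 1) : |x * y| ≤ |y| := by
    rw [abs_mul]; exact mul_le_of_le_one_left (abs_nonneg _) hx
  have i1 : Integrable (fun q : EuclideanSpace ℂ (Fin n) × EuclideanSpace ℂ (Fin n) =>
      weightFst (inner ℂ x₀ q.1, inner ℂ x₀ q.2) * intensity u q.1)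
      ((complexGaussian n).prod (complexGaussian n)) :=
    ((integrable_intensity u).comp_fst (complexGaussian n)).mono' (by fun_prop)
      (ae_of_all _ fun p => (hmul (abs_weightFst_le_one _)).trans_eq
        (abs_of_nonneg (intensity_nonneg _ _)))
  have i2 : Integrable (fun q : EuclideanSpace ℂ (Fin n) × EuclideanSpace ℂ (Fin n) =>
      weightSnd (inner ℂ x₀ q.1, inner ℂ x₀ q.2) * intensity u q.2)
      ((complexGaussian n).prod (complexGaussian n)) :=
    ((integrable_intensity u).comp_snd (complexGaussian n)).mono' (by fun_prop)
      (ae_of_all _ fun p => (hmul (abs_weightSnd_le_one _)).trans_eq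
        (abs_of_nonneg (intensity_nonneg _ _)))
  have j1 : Integrable (fun p : ℂ × ℂ => weightFst p * (t * ‖p.1‖ ^ 2 + (1 - t)))
      (complexNormal.prod complexNormal) :=
    Integrable.mono' (((integrable_norm_sq_complexNormal.const_mul _).add
      (integrable_const _)).comp_fst complexNormal).abs (by fun_prop)
      (ae_of_all _ fun p => hmul (abs_weightFst_le_one p))
  have j2 : Integrable (fun p : ℂ × ℂ => weightSnd p * (t * ‖p.2‖ ^ 2 + (1 - t)))
      (complexNormal.prod complexNormal) :=
    Integrable.mono' (((integrable_norm_sq_complexNormal.const_mul _).add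
      (integrable_const _)).comp_snd complexNormal).abs (by fun_prop)
      (ae_of_all _ fun p => hmul (abs_weightSnd_le_one p))
  simp_rw [pairForm_eq]
  rw [integral_sub i1 i2, integral_mul_intensity_fst hx hu hw1 abs_weightFst_le_one,
    integral_mul_intensity_snd hx hu hw2 abs_weightSnd_le_one, ← integral_sub j1 j2]
  have hpt (p : ℂ × ℂ) : weightFst p * (t * ‖p.1‖ ^ 2 + (1 - t)) -
      weightSnd p * (t * ‖p.2‖ ^ 2 + (1 - t)) =
      t * |‖p.1‖ ^ 2 - ‖p.2‖ ^ 2| +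
        (1 - t) * (|‖p.1‖ ^ 2 - ‖p.2‖ ^ 2| / (‖p.1‖ ^ 2 + ‖p.2‖ ^ 2)) := by
    rw [← bit_mul_sub, weightFst, weightSnd]
    -- If both intensities vanish, all quotients are `0 / 0 = 0` and both sides are zero.
    rcases eq_or_ne (‖p.1‖ ^ 2 + ‖p.2‖ ^ 2) 0 with h | h
    · have h3 : ‖p.1‖ ^ 2 = 0 := by linarith [sq_nonneg ‖p.1‖, sq_nonneg ‖p.2‖]
      have h4 : ‖p.2‖ ^ 2 = 0 := by linarith [sq_nonneg ‖p.1‖, sq_nonneg ‖p.2‖]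
      rw [h3, h4]
      simp
    · field_simp
      ring
  simp_rw [hpt]
  rw [integral_add (integrable_abs_sub.const_mul _) (integrable_ratio.const_mul _),
    integral_const_mul, integral_const_mul, intensity_eq, ← ht, meanAlong, meanAcross]
  ring

end

/-! ### Bernstein's inequality for subexponential variables -/

section

lemma exp_le_one_add_add_sq_mul_exp_abs (x : ℝ) : Real.exp x ≤ 1 + x + x ^ 2 * Real.exp |x| := by
  have h := Complex.norm_exp_sub_sum_le_norm_mul_exp (x : ℂ) 2
  simp only [Finset.sum_range_succ, Finset.sum_range_zero] at h
  rw [Complex.norm_real, Real.norm_eq_abs, sq_abs] at h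
  have h2 : (Complex.exp x - (0 + (x : ℂ) ^ 0 / (Nat.factorial 0 : ℂ) +
      (x : ℂ) ^ 1 / (Nat.factorial 1 : ℂ))) = ((Real.exp x - (1 + x) : ℝ) : ℂ) := by
    push_cast
    simp
  rw [h2, Complex.norm_real, Real.norm_eq_abs] at h
  linarith [le_abs_self (Real.exp x - (1 + x))]

variable {Ω : Type*} [MeasurableSpace Ω] {P : Measure Ω}

lemma integrable_of_integrable_exp_abs {X : Ω → ℝ} (hX : AEMeasurable X P)
    (hi : Integrable (fun ω => Real.exp (|X ω| / 2)) P) : Integrable X P := by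
  refine (hi.const_mul 2).mono' hX.aestronglyMeasurable (ae_of_all _ fun ω => ?_)
  rw [Real.norm_eq_abs]
  linarith [Real.add_one_le_exp (|X ω| / 2)]

lemma integrable_exp_mul_of_integrable_exp_abs {X : Ω → ℝ} (hX : AEMeasurable X P)
    (hi : Integrable (fun ω => Real.exp (|X ω| / 2)) P) {l : ℝ} (hl : |l| ≤ 1 / 4) :
    Integrable (fun ω => Real.exp (l * X ω)) P := by
  refine hi.mono' (hX.const_mul l).exp.aestronglyMeasurable (ae_of_all _ fun ω => ?_)
  rw [Real.norm_of_nonneg (Real.exp_pos _).le, Real.exp_le_exp]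
  have := (le_abs_self (l * X ω)).trans_eq (abs_mul _ _)
  nlinarith [abs_nonneg (X ω)]

variable [IsProbabilityMeasure P]

/-- A variable with `𝔼 exp (|X| / 2) ≤ M` is subexponential around its mean. -/
lemma mgf_le_of_integral_exp_abs_le {X : Ω → ℝ} (hX : AEMeasurable X P) {M : ℝ}
    (hi : Integrable (fun ω => Real.exp (|X ω| / 2)) P)
    (hM : ∫ ω, Real.exp (|X ω| / 2) ∂P ≤ M) {l : ℝ} (hl : |l| ≤ 1 / 4) :
    mgf X P l ≤ Real.exp (l * ∫ ω, X ω ∂P + 32 * M * l ^ 2) := by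
  have hXi := integrable_of_integrable_exp_abs hX hi
  have hpt (ω : Ω) : Real.exp (l * X ω) ≤
      1 + l * X ω + 32 * l ^ 2 * Real.exp (|X ω| / 2) := by
    refine (exp_le_one_add_add_sq_mul_exp_abs _).trans (add_le_add_right ?_ _)
    have h1 : |l * X ω| ≤ |X ω| / 4 := by
      rw [abs_mul]; nlinarith [abs_nonneg (X ω)]
    have h2 : X ω ^ 2 ≤ 32 * Real.exp (|X ω| / 4) := by
      have := Real.quadratic_le_exp_of_nonneg (x := |X ω| / 4) (by positivity)
      have h0 := sq_abs (X ω)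
      have := abs_nonneg (X ω)
      nlinarith
    calc (l * X ω) ^ 2 * Real.exp |l * X ω|
        ≤ (l ^ 2 * (32 * Real.exp (|X ω| / 4))) * Real.exp (|X ω| / 4) := by
          rw [mul_pow]
          gcongr
      _ = 32 * l ^ 2 * Real.exp (|X ω| / 2) := by
          rw [show |X ω| / 2 = |X ω| / 4 + |X ω| / 4 by ring, Real.exp_add]
          ring
  have i1 : Integrable (fun ω => 1 + l * X ω) P := (integrable_const _).add (hXi.const_mul l)
  have h := integral_mono (integrable_exp_mul_of_integrable_exp_abs hX hi hl)
    (i1.add (hi.const_mul (32 * l ^ 2))) hpt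
  rw [mgf]
  refine h.trans ?_
  simp only [Pi.add_apply]
  rw [integral_add i1 (hi.const_mul _), integral_add (integrable_const _) (hXi.const_mul l),
    integral_const_mul, integral_const_mul, integral_const, probReal_univ, one_smul]
  refine le_trans ?_ (Real.add_one_le_exp _)
  have := mul_le_mul_of_nonneg_left hM (by positivity : 0 ≤ 32 * l ^ 2)
  linarith

/-- Bernstein's upper tail bound for independent subexponential variables with a common mean. -/
lemma measure_sum_ge_le {m : ℕ} {X : Fin m → Ω → ℝ} (hX : ∀ i, AEMeasurable (X i) P)
    (hind : iIndepFun X P) {M e : ℝ} (hM0 : 0 < M)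
    (hi : ∀ i, Integrable (fun ω => Real.exp (|X i ω| / 2)) P)
    (hM : ∀ i, ∫ ω, Real.exp (|X i ω| / 2) ∂P ≤ M) (he : ∀ i, ∫ ω, X i ω ∂P = e)
    {t : ℝ} (ht : 0 ≤ t) (htM : t ≤ 16 * M) :
    P.real {ω | m * (e + t) ≤ ∑ i, X i ω} ≤ Real.exp (-(m * t ^ 2 / (128 * M))) := by
  -- The minimizer of the exponent `32 M l² - l t`; the bound on `t` keeps it within `1/4`.
  set l := t / (64 * M) with hl
  have hl0 : 0 ≤ l := by positivity
  have hl1 : |l| ≤ 1 / 4 := by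
    rw [abs_of_nonneg hl0, hl, div_le_iff₀ (by positivity)]
    linarith
  have hint : Integrable (fun ω => Real.exp (l * (∑ i, X i) ω)) P := by
    by_contra hni
    have h0 := hind.mgf_sum₀ hX Finset.univ (t := l)
    rw [mgf_undef hni] at h0
    exact (Finset.prod_pos fun i _ => mgf_pos
      (integrable_exp_mul_of_integrable_exp_abs (hX i) (hi i) hl1)).ne h0
  have h := measure_ge_le_exp_mul_mgf (m * (e + t)) hl0 hint
  simp only [Finset.sum_apply] at h
  refine h.trans ?_
  rw [hind.mgf_sum₀ hX]
  have hprod : ∏ i, mgf (X i) P l ≤ ∏ _i : Fin m, Real.exp (l * e + 32 * M * l ^ 2) := by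
    refine Finset.prod_le_prod (fun i _ => mgf_nonneg) fun i _ => ?_
    rw [← he i]
    exact mgf_le_of_integral_exp_abs_le (hX i) (hi i) (hM i) hl1
  refine (mul_le_mul_of_nonneg_left hprod (Real.exp_pos _).le).trans_eq ?_
  rw [Finset.prod_const, Finset.card_univ, Fintype.card_fin, ← Real.exp_nat_mul, ← Real.exp_add]
  congr 1
  rw [hl]
  field_simp
  ring

lemma measure_abs_mean_sub_gt_le {m : ℕ} (hm : 0 < m) {X : Fin m → Ω → ℝ}
    (hX : ∀ i, AEMeasurable (X i) P)
    (hind : iIndepFun X P) {M e : ℝ} (hM0 : 0 < M)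
    (hi : ∀ i, Integrable (fun ω => Real.exp (|X i ω| / 2)) P)
    (hM : ∀ i, ∫ ω, Real.exp (|X i ω| / 2) ∂P ≤ M) (he : ∀ i, ∫ ω, X i ω ∂P = e)
    {t : ℝ} (ht : 0 ≤ t) (htM : t ≤ 16 * M) :
    P.real {ω | t < |1 / (m : ℝ) * ∑ i, X i ω - e|} ≤
      2 * Real.exp (-(m * t ^ 2 / (128 * M))) := by
  have hm' : (0 : ℝ) < m := by exact_mod_cast hm
  have h1 := measure_sum_ge_le hX hind hM0 hi hM he ht htM
  have h2 := measure_sum_ge_le (X := fun i ω => -X i ω) (e := -e) (fun i => (hX i).neg)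
    (hind.comp (fun _ x => -x) fun _ => measurable_neg) hM0 (by simpa only [abs_neg] using hi)
    (by simpa only [abs_neg] using hM) (fun i => by rw [integral_neg, he i]) ht htM
  refine (measureReal_mono ?_).trans ((measureReal_union_le _ _).trans
    ((add_le_add h1 h2).trans_eq (two_mul _).symm))
  intro ω hω
  have hω : t < |1 / (m : ℝ) * ∑ i, X i ω - e| := hω
  have hs : (m : ℝ) * (1 / (m : ℝ) * ∑ i, X i ω) = ∑ i, X i ω := by field_simp
  rcases lt_abs.1 hω with h | h
  · left
    change m * (e + t) ≤ ∑ i, X i ω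
    rw [← hs]
    exact mul_le_mul_of_nonneg_left (by linarith) hm'.le
  · right
    change m * (-e + t) ≤ ∑ i, -X i ω
    rw [Finset.sum_neg_distrib, ← hs, ← mul_neg]
    exact mul_le_mul_of_nonneg_left (by linarith) hm'.le

/-- Grouping an independent family into pairs gives independent pairs: the joint law is a product
measure, which currying turns into a product of products. -/
lemma iIndepFun_pairs {m : ℕ} {E : Type*} [MeasurableSpace E] {a : Fin m × Fin 2 → Ω → E}
    (ha : ∀ p, AEMeasurable (a p) P) (hind : iIndepFun a P) :
    iIndepFun (fun i ω => (a (i, 0) ω, a (i, 1) ω)) P := by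
  have hs : iIndepFun (fun (p : (_ : Fin m) × Fin 2) => a (p.1, p.2)) P :=
    hind.precomp (Equiv.sigmaEquivProd (Fin m) (Fin 2)).injective
  have hrow (i : Fin m) : iIndepFun (fun j => a (i, j)) P :=
    hind.precomp (Prod.mk_right_injective i)
  have (p : Fin m × Fin 2) : IsProbabilityMeasure (P.map (a p)) :=
    Measure.isProbabilityMeasure_map (ha p)
  have hmrow (i : Fin m) : AEMeasurable (fun ω j => a (i, j) ω) P :=
    aemeasurable_pi_iff.2 fun j => ha _
  have hblock : iIndepFun (fun i ω j => a (i, j) ω) P := by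
    rw [iIndepFun_iff_map_fun_eq_infinitePi_map₀' hmrow]
    have h1 := (iIndepFun_iff_map_fun_eq_infinitePi_map₀'
      (fun p : (_ : Fin m) × Fin 2 => ha (p.1, p.2))).1 hs
    have h2 := congrArg (Measure.map (MeasurableEquiv.piCurry fun (_ : Fin m) (_ : Fin 2) => E)) h1
    have hm : AEMeasurable (fun ω (p : (_ : Fin m) × Fin 2) => a (p.1, p.2) ω) P :=
      aemeasurable_pi_iff.2 fun p => ha (p.1, p.2)
    rw [AEMeasurable.map_map_of_aemeasurable (by fun_prop) hm,
      Measure.infinitePi_map_piCurry (fun i j => P.map (a (i, j)))] at h2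
    refine Eq.trans ?_ (h2.trans ?_)
    · rfl
    · congr 1
      funext i
      exact ((iIndepFun_iff_map_fun_eq_infinitePi_map₀' fun j => ha (i, j)).1 (hrow i)).symm
  exact hblock.comp (fun _ v => (v 0, v 1)) fun _ => by fun_prop

end

/-! ### Nets, quadratic forms on the sphere, and top eigenvectors -/

section

variable {n : ℕ}

/-- The volume bound for separated sets in real dimension `2 n`, where `25 ^ n = 5 ^ (2 n)`. -/
lemma card_le_of_separated_unit {s : Finset (EuclideanSpace ℂ (Fin n))}
    (hs : ∀ c ∈ s, ‖c‖ = 1) (h : ∀ c ∈ s, ∀ d ∈ s, c ≠ d → 1 / 2 ≤ ‖c - d‖) :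
    s.card ≤ 25 ^ n := by
  classical
  have hinj : Function.Injective fun c : EuclideanSpace ℂ (Fin n) => (2 : ℝ) • c :=
    smul_right_injective _ two_ne_zero
  have hcard := Besicovitch.card_le_of_separated (s.image fun c => (2 : ℝ) • c)
    (by
      simp only [Finset.mem_image, forall_exists_index, and_imp, forall_apply_eq_imp_iff₂]
      intro c hc
      rw [norm_smul, hs c hc]
      norm_num)
    (by
      simp only [Finset.mem_image, forall_exists_index, and_imp, forall_apply_eq_imp_iff₂]
      intro c hc d hd hne
      have := h c hc d hd fun hcd => hne (by rw [hcd])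
      rw [← smul_sub, norm_smul, Real.norm_of_nonneg zero_le_two]
      linarith)
  rw [Finset.card_image_of_injective _ hinj] at hcard
  refine hcard.trans_eq ?_
  rw [show Module.finrank ℝ (EuclideanSpace ℂ (Fin n)) = 2 * n by
    have := finrank_real_of_complex (EuclideanSpace ℂ (Fin n))
    rwa [finrank_euclideanSpace_fin] at this, pow_mul]
  norm_num

/-- A separated subset of the unit sphere of maximal cardinality is a `1/2`-net. -/
lemma exists_net (n : ℕ) : ∃ N : Finset (EuclideanSpace ℂ (Fin n)), N.card ≤ 25 ^ n ∧
    (∀ v ∈ N, ‖v‖ = 1) ∧ ∀ u : EuclideanSpace ℂ (Fin n), ‖u‖ = 1 → ∃ v ∈ N, ‖u - v‖ ≤ 1 / 2 := by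
  classical
  let S : Set ℕ := {k | ∃ s : Finset (EuclideanSpace ℂ (Fin n)), s.card = k ∧
    (∀ c ∈ s, ‖c‖ = 1) ∧ ∀ c ∈ s, ∀ d ∈ s, c ≠ d → 1 / 2 ≤ ‖c - d‖}
  have hbdd : BddAbove S := ⟨25 ^ n, by
    rintro k ⟨s, rfl, h1, h2⟩
    exact card_le_of_separated_unit h1 h2⟩
  obtain ⟨N, hN, h1, h2⟩ := Nat.sSup_mem (s := S) ⟨0, ∅, by simp⟩ hbdd
  refine ⟨N, card_le_of_separated_unit h1 h2, h1, fun u hu => ?_⟩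
  by_contra! hfar
  have huN : u ∉ N := fun h => by
    have := hfar u h
    rw [sub_self, norm_zero] at this
    linarith
  have hmem : N.card + 1 ∈ S := by
    refine ⟨insert u N, Finset.card_insert_of_notMem huN, ?_, ?_⟩
    · intro c hc
      rcases Finset.mem_insert.1 hc with rfl | hc
      · exact hu
      · exact h1 c hc
    · intro c hc d hd hne
      rcases Finset.mem_insert.1 hc with hcu | hcN <;>
        rcases Finset.mem_insert.1 hd with hdu | hdN
      · exact absurd (hcu.trans hdu.symm) hne
      · rw [hcu]
        exact (hfar d hdN).le
      · rw [hdu, norm_sub_rev]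
        exact (hfar c hcN).le
      · exact h2 c hcN d hdN hne
  have := le_csSup hbdd hmem
  omega

lemma continuous_quadForm (M : Matrix (Fin n) (Fin n) ℂ) : Continuous (quadForm M) := by
  unfold quadForm
  have h : Continuous fun x : EuclideanSpace ℂ (Fin n) => x.ofLp := PiLp.continuous_ofLp 2 _
  exact Complex.continuous_re.comp (h.star.dotProduct (Continuous.matrix_mulVec continuous_const h))

lemma quadForm_smul_add_smul (M : Matrix (Fin n) (Fin n) ℂ) (b c : ℝ)
    (u v : EuclideanSpace ℂ (Fin n)) :
    quadForm M (b • u + c • v) = b ^ 2 * quadForm M u + c ^ 2 * quadForm M v +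
      b * c * ((star u.ofLp ⬝ᵥ M.mulVec v.ofLp).re + (star v.ofLp ⬝ᵥ M.mulVec u.ofLp).re) := by
  simp only [quadForm, ofLp_add, ofLp_smul, star_add, star_smul, Matrix.mulVec_add,
    Matrix.mulVec_smul, dotProduct_add, add_dotProduct, smul_dotProduct, dotProduct_smul,
    Complex.add_re, star_trivial, Complex.smul_re, smul_eq_mul]
  ring

lemma quadForm_real_smul (M : Matrix (Fin n) (Fin n) ℂ) (b : ℝ) (u : EuclideanSpace ℂ (Fin n)) :
    quadForm M (b • u) = b ^ 2 * quadForm M u := by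
  have h := quadForm_smul_add_smul M b 0 u u
  simpa using h

/-- Polarization: with `p = 2 (u - v)` and `w = (u + v) / 2` the right-hand side is
`q (p + w) - q (p - w)`. The weights `2` and `1/2` make the bound of `abs_quadForm_le_of_net` a
contraction. -/
lemma four_mul_quadForm_sub (M : Matrix (Fin n) (Fin n) ℂ) (u v : EuclideanSpace ℂ (Fin n)) :
    4 * (quadForm M u - quadForm M v) =
      quadForm M ((5 / 2 : ℝ) • u + (-3 / 2 : ℝ) • v) -
        quadForm M ((3 / 2 : ℝ) • u + (-5 / 2 : ℝ) • v) := by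
  rw [quadForm_smul_add_smul, quadForm_smul_add_smul]
  ring

lemma norm_sq_add_norm_sq_eq {u v : EuclideanSpace ℂ (Fin n)} (hu : ‖u‖ = 1) (hv : ‖v‖ = 1) :
    ‖(5 / 2 : ℝ) • u + (-3 / 2 : ℝ) • v‖ ^ 2 + ‖(3 / 2 : ℝ) • u + (-5 / 2 : ℝ) • v‖ ^ 2 =
      2 + 15 / 2 * ‖u - v‖ ^ 2 := by
  rw [norm_add_sq_real, norm_add_sq_real, norm_sub_sq_real]
  simp only [norm_smul, hu, hv, real_inner_smul_left, real_inner_smul_right, mul_pow,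
    Real.norm_eq_abs, sq_abs]
  ring

/-- A quadratic form is controlled on the unit sphere by its values on a `1/2`-net. At a maximizer
`x` of `|q|` with nearest net point `v`, polarization gives `|q x - q v| ≤ (31/32) |q x|`. -/
lemma abs_quadForm_le_of_net {N : Finset (EuclideanSpace ℂ (Fin n))}
    (hN : ∀ v ∈ N, ‖v‖ = 1)
    (hnet : ∀ u : EuclideanSpace ℂ (Fin n), ‖u‖ = 1 → ∃ v ∈ N, ‖u - v‖ ≤ 1 / 2)
    {M : Matrix (Fin n) (Fin n) ℂ} {t : ℝ} (ht : ∀ v ∈ N, |quadForm M v| ≤ t)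
    {u : EuclideanSpace ℂ (Fin n)} (hu : ‖u‖ = 1) : |quadForm M u| ≤ 32 * t := by
  obtain ⟨x, hx, hmax⟩ := (isCompact_sphere (0 : EuclideanSpace ℂ (Fin n)) 1).exists_isMaxOn
    ⟨u, by simpa using hu⟩ (continuous_quadForm M).abs.continuousOn
  have hx1 : ‖x‖ = 1 := by simpa using hx
  have hmax' (w : EuclideanSpace ℂ (Fin n)) (hw : ‖w‖ = 1) : |quadForm M w| ≤ |quadForm M x| :=
    hmax (show w ∈ Metric.sphere (0 : EuclideanSpace ℂ (Fin n)) 1 by simpa using hw)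
  have hall (w : EuclideanSpace ℂ (Fin n)) : |quadForm M w| ≤ |quadForm M x| * ‖w‖ ^ 2 := by
    rcases eq_or_ne w 0 with rfl | hw
    · have := quadForm_real_smul M 0 (0 : EuclideanSpace ℂ (Fin n))
      rw [zero_smul] at this
      rw [this]
      simp
    · have hw0 := norm_ne_zero_iff.2 hw
      have h1 := hmax' (‖w‖⁻¹ • w) (by rw [norm_smul, norm_inv, norm_norm, inv_mul_cancel₀ hw0])
      have h2 := quadForm_real_smul M ‖w‖ (‖w‖⁻¹ • w)
      rw [smul_smul, mul_inv_cancel₀ hw0, one_smul] at h2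
      rw [h2, abs_mul, abs_of_nonneg (sq_nonneg _), mul_comm]
      exact mul_le_mul_of_nonneg_right h1 (sq_nonneg _)
  obtain ⟨v, hv, hxv⟩ := hnet x hx1
  have h4 := four_mul_quadForm_sub M x v
  have h5 := norm_sq_add_norm_sq_eq hx1 (hN v hv)
  set y := (5 / 2 : ℝ) • x + (-3 / 2 : ℝ) • v
  set z := (3 / 2 : ℝ) • x + (-5 / 2 : ℝ) • v
  have h6 : |4 * (quadForm M x - quadForm M v)| ≤ |quadForm M x| * (31 / 8) := by
    rw [h4]
    refine (abs_sub _ _).trans ((add_le_add (hall y) (hall z)).trans ?_)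
    rw [← mul_add, h5]
    refine mul_le_mul_of_nonneg_left ?_ (abs_nonneg _)
    nlinarith [norm_nonneg (x - v)]
  rw [abs_mul, abs_of_pos (by norm_num : (0 : ℝ) < 4)] at h6
  have h7 := abs_sub_abs_le_abs_sub (quadForm M x) (quadForm M v)
  have h8 := ht v hv
  have h9 := hmax' u hu
  linarith

/-- The phase of `⟨x₀, x⟩` realizes the distance of `x` from the circle of unit multiples
of `x₀`. -/
lemma exists_phase {x₀ x : EuclideanSpace ℂ (Fin n)} (hx₀ : ‖x₀‖ = 1) (hx : ‖x‖ = 1) :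
    ∃ φ ∈ Set.Icc (0 : ℝ) (2 * Real.pi),
      ‖x - Complex.exp (φ * Complex.I) • x₀‖ ^ 2 = 2 - 2 * ‖inner ℂ x₀ x‖ := by
  set c : ℂ := inner ℂ x₀ x with hc
  obtain ⟨φ, hφ, hφc⟩ : ∃ φ ∈ Set.Icc (0 : ℝ) (2 * Real.pi),
      (‖c‖ : ℂ) * Complex.exp (φ * Complex.I) = c := by
    rcases le_or_gt 0 c.arg with h | h
    · exact ⟨c.arg, ⟨h, (Complex.arg_le_pi c).trans (by linarith [Real.pi_pos])⟩,
        Complex.norm_mul_exp_arg_mul_I c⟩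
    · refine ⟨c.arg + 2 * Real.pi, ⟨by linarith [Complex.neg_pi_lt_arg c, Real.pi_pos],
        by linarith⟩, ?_⟩
      push_cast
      rw [add_mul, Complex.exp_add, Complex.exp_two_pi_mul_I, mul_one,
        Complex.norm_mul_exp_arg_mul_I]
  refine ⟨φ, hφ, ?_⟩
  have he : ‖Complex.exp (φ * Complex.I)‖ = 1 := Complex.norm_exp_ofReal_mul_I φ
  have hin : (inner ℂ x (Complex.exp (φ * Complex.I) • x₀)).re = ‖c‖ := by
    rw [inner_smul_right, ← inner_conj_symm x x₀, ← hc]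
    nth_rewrite 1 [← hφc]
    rw [map_mul, Complex.conj_ofReal, mul_left_comm, Complex.mul_conj, Complex.normSq_eq_norm_sq,
      he]
    simp
  rw [norm_sub_sq (𝕜 := ℂ), norm_smul, he, hx, hx₀]
  change 1 ^ 2 - 2 * (inner ℂ x (Complex.exp (φ * Complex.I) • x₀)).re + (1 * 1) ^ 2 = _
  rw [hin]
  ring

lemma quadForm_one (u : EuclideanSpace ℂ (Fin n)) : quadForm 1 u = ‖u‖ ^ 2 := by
  have h : star u.ofLp ⬝ᵥ u.ofLp = inner ℂ u u := by
    rw [EuclideanSpace.inner_eq_star_dotProduct, dotProduct_comm]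
  rw [quadForm, Matrix.one_mulVec, h]
  exact inner_self_eq_norm_sq (𝕜 := ℂ) u

/-- The expectation of the weighted one-bit matrix. -/
noncomputable def meanMatrix (x₀ : EuclideanSpace ℂ (Fin n)) : Matrix (Fin n) (Fin n) ℂ :=
  meanAcross • (1 : Matrix (Fin n) (Fin n) ℂ) + (meanAlong - meanAcross) • outer x₀

lemma quadForm_meanMatrix (x₀ u : EuclideanSpace ℂ (Fin n)) :
    quadForm (meanMatrix x₀) u =
      meanAcross * ‖u‖ ^ 2 + (meanAlong - meanAcross) * ‖inner ℂ x₀ u‖ ^ 2 := by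
  rw [meanMatrix, quadForm_add, quadForm_smul, quadForm_smul, quadForm_one, quadForm_outer,
    intensity]

/-- A top eigenvector of a matrix close to the mean matrix is close to `x₀`, by the spectral gap. -/
lemma exists_phase_of_isTopEigenvector {x₀ x : EuclideanSpace ℂ (Fin n)} (hx₀ : ‖x₀‖ = 1)
    {M : Matrix (Fin n) (Fin n) ℂ} (hx : IsTopEigenvector M x) {r : ℝ}
    (hM : ∀ u : EuclideanSpace ℂ (Fin n), ‖u‖ = 1 → |quadForm (M - meanMatrix x₀) u| ≤ r) :
    ∃ φ ∈ Set.Icc (0 : ℝ) (2 * Real.pi), ‖x - Complex.exp (φ * Complex.I) • x₀‖ ^ 2 ≤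
      4 * r / (meanAlong - meanAcross) := by
  obtain ⟨φ, hφ, h⟩ := exists_phase hx₀ hx.1
  refine ⟨φ, hφ, ?_⟩
  have hgap := sub_pos.2 meanAcross_lt_meanAlong
  have h1 := hx.2 x₀ hx₀
  have h2 := (abs_le.1 (hM x hx.1)).2
  have h3 := (abs_le.1 (hM x₀ hx₀)).1
  rw [quadForm_sub, quadForm_meanMatrix] at h2 h3
  have h4 : ‖inner ℂ x₀ x‖ ≤ 1 := by
    simpa [hx₀, hx.1] using norm_inner_le_norm (𝕜 := ℂ) x₀ x
  have h5 : ‖inner ℂ x₀ x₀‖ = 1 := by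
    rw [inner_self_eq_norm_sq_to_K, hx₀]
    simp
  rw [hx.1] at h2
  rw [h5, hx₀] at h3
  rw [h, le_div_iff₀ hgap]
  nlinarith [mul_nonneg hgap.le (mul_nonneg (norm_nonneg (inner ℂ x₀ x)) (sub_nonneg.2 h4))]

end

/-! ### Concentration and recovery -/

/-- Concentration of the weighted matrix around its mean in a fixed direction. -/
lemma measure_abs_quadForm_gt_le {n m : ℕ} (hm : 0 < m) {x₀ u : EuclideanSpace ℂ (Fin n)}
    (hx₀ : ‖x₀‖ = 1) (hu : ‖u‖ = 1) {Ω : Type*} [MeasurableSpace Ω] {P : Measure Ω}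
    [IsProbabilityMeasure P] {a : Fin m × Fin 2 → Ω → EuclideanSpace ℂ (Fin n)}
    (ha : ∀ p, HasLaw (a p) (complexGaussian n) P) (hind : iIndepFun a P) {t : ℝ} (ht : 0 ≤ t)
    (ht64 : t ≤ 64) :
    P.real {ω | t < |quadForm (weightedMatrix x₀ (fun p => a p ω) - meanMatrix x₀) u|} ≤
      2 * Real.exp (-(m * t ^ 2 / 512)) := by
  have hmeas := measurable_pairForm x₀ u
  have hpair (i : Fin m) : HasLaw (fun ω => (a (i, 0) ω, a (i, 1) ω))
      ((complexGaussian n).prod (complexGaussian n)) P := by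
    have hne : ((i, 0) : Fin m × Fin 2) ≠ (i, 1) := by simp
    refine ⟨(ha _).aemeasurable.prodMk (ha _).aemeasurable, ?_⟩
    rw [(indepFun_iff_map_prod_eq_prod_map_map (ha _).aemeasurable (ha _).aemeasurable).1
      (hind.indepFun hne), (ha _).map_eq, (ha _).map_eq]
  have hX (i : Fin m) : AEMeasurable (fun ω => pairForm x₀ u (a (i, 0) ω, a (i, 1) ω)) P :=
    hmeas.comp_aemeasurable (hpair i).aemeasurable
  have hexp : Measurable fun q => Real.exp (|pairForm x₀ u q| / 2) :=
    ((continuous_abs.measurable.comp hmeas).div_const 2).exp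
  have hi (i : Fin m) : Integrable
      (fun ω => Real.exp (|pairForm x₀ u (a (i, 0) ω, a (i, 1) ω)| / 2)) P := by
    have h := integrable_exp_abs_pairForm x₀ hu
    rw [← (hpair i).map_eq] at h
    exact h.comp_aemeasurable (hpair i).aemeasurable
  have hM (i : Fin m) :
      ∫ ω, Real.exp (|pairForm x₀ u (a (i, 0) ω, a (i, 1) ω)| / 2) ∂P ≤ 4 := by
    refine le_of_eq_of_le ?_ (integral_exp_abs_pairForm_le x₀ hu)
    rw [← (hpair i).map_eq, integral_map (hpair i).aemeasurable hexp.aestronglyMeasurable]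
  have he (i : Fin m) : ∫ ω, pairForm x₀ u (a (i, 0) ω, a (i, 1) ω) ∂P =
      quadForm (meanMatrix x₀) u := by
    rw [quadForm_meanMatrix, hu, one_pow, mul_one, ← norm_inner_symm, ← intensity,
      ← integral_pairForm hx₀ hu, ← (hpair i).map_eq,
      integral_map (hpair i).aemeasurable hmeas.aestronglyMeasurable]
  have hindX : iIndepFun (fun i ω => pairForm x₀ u (a (i, 0) ω, a (i, 1) ω)) P :=
    (iIndepFun_pairs (fun p => (ha p).aemeasurable) hind).comp (fun _ => pairForm x₀ u)
      fun _ => hmeas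
  have h := measure_abs_mean_sub_gt_le hm hX hindX (M := 4) (by norm_num) hi hM he ht
    (by linarith)
  convert h using 4
  · rw [quadForm_sub, weightedMatrix, quadForm_smul, quadForm_sum]
    rfl
  · norm_num

/-- The union bound over a net of `25 ^ n` points. -/
lemma card_mul_exp_le {n : ℕ} (hn : 2 ≤ n) {s : ℝ} (hs : 10 * (n * Real.log n) ≤ s) :
    (25 : ℝ) ^ n * (2 * Real.exp (-s)) ≤ 2 / (n : ℝ) ^ 2 := by
  have hn2 : (2 : ℝ) ≤ n := by exact_mod_cast hn
  have hn0 : (0 : ℝ) < n := by linarith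
  have hlog : 0 ≤ Real.log n := Real.log_nonneg (by linarith)
  have h25 : Real.log 25 ≤ 5 * Real.log n := by
    have h1 : Real.log 25 ≤ Real.log (2 ^ 5) := Real.log_le_log (by norm_num) (by norm_num)
    rw [Real.log_pow] at h1
    have h2 : Real.log 2 ≤ Real.log n := Real.log_le_log (by norm_num) hn2
    push_cast at h1
    linarith
  have h1 : (25 : ℝ) ^ n = Real.exp (n * Real.log 25) := by
    rw [Real.exp_nat_mul, Real.exp_log (by norm_num)]
  have h2 : 2 / (n : ℝ) ^ 2 = 2 * Real.exp (-(2 * Real.log n)) := by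
    rw [Real.exp_neg, show 2 * Real.log n = ((2 : ℕ) : ℝ) * Real.log n by norm_num,
      Real.exp_nat_mul, Real.exp_log hn0, div_eq_mul_inv]
  rw [h1, h2, mul_left_comm, ← Real.exp_add]
  refine mul_le_mul_of_nonneg_left (Real.exp_le_exp.2 ?_) zero_le_two
  nlinarith [mul_le_mul_of_nonneg_left h25 hn0.le]

end OneBitPhase

theorem theorem2 :
    ∃ C K : ℝ, 0 < C ∧ 0 < K ∧
      ∀ (n m : ℕ) (x₀ : EuclideanSpace ℂ (Fin n)), ‖x₀‖ = 1 →
      ∀ ε : ℝ, 0 < ε → ε ≤ 1 →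
      C / ε ^ 2 * n * Real.log n ≤ m →
      ∀ (Ω : Type*) [MeasurableSpace Ω] (P : MeasureTheory.Measure Ω)
        [MeasureTheory.IsProbabilityMeasure P]
        (a : Fin m × Fin 2 → Ω → EuclideanSpace ℂ (Fin n)),
      (∀ p, ProbabilityTheory.HasLaw (a p) (OneBitPhase.complexGaussian n) P) →
      ProbabilityTheory.iIndepFun a P →
      ∃ E : Set Ω, MeasurableSet E ∧ 1 - K / (n : ℝ) ^ 2 ≤ P.real E ∧
        ∀ ω ∈ E, ∀ x : EuclideanSpace ℂ (Fin n),
          OneBitPhase.IsTopEigenvector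
            (OneBitPhase.weightedMatrix x₀ fun p => a p ω) x →
          ∃ φ ∈ Set.Icc (0 : ℝ) (2 * Real.pi),
            ‖x - Complex.exp (φ * Complex.I) • x₀‖ ^ 2 ≤ ε := by
  have hgap := sub_pos.2 OneBitPhase.meanAcross_lt_meanAlong
  set g := OneBitPhase.meanAlong - OneBitPhase.meanAcross with hg
  -- The minimum with `1` keeps the deviation `t` below within the range of Bernstein's bound.
  set d := min g 1 with hd
  have hd0 : 0 < d := lt_min hgap one_pos
  refine ⟨10 * 512 * 128 ^ 2 / d ^ 2, 2, by positivity, by norm_num, ?_⟩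
  intro n m x₀ hx₀ ε hε hε1 hm Ω _ P _ a ha hind
  -- For `n = 1` the probability bound is negative, and `n = 0` has no unit vector.
  rcases lt_or_ge n 2 with hn | hn
  · refine ⟨∅, MeasurableSet.empty, ?_, by simp⟩
    have hn1 : n = 1 := by
      have : n ≠ 0 := by
        rintro rfl
        rw [Subsingleton.elim x₀ 0, norm_zero] at hx₀
        exact zero_ne_one hx₀
      omega
    rw [hn1]
    norm_num
  have hn2 : (2 : ℝ) ≤ n := by exact_mod_cast hn
  have hlog : 0 < Real.log n := Real.log_pos (by linarith)
  have hm0 : 0 < m := by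
    have : (0 : ℝ) < m := lt_of_lt_of_le (by positivity) hm
    exact_mod_cast this
  -- The net loses a factor `32` and the eigenvector comparison a factor `4`.
  set t := ε * d / 128 with ht
  have ht0 : 0 < t := by positivity
  have ht64 : t ≤ 64 := by
    have : ε * d ≤ 1 * 1 := mul_le_mul hε1 (min_le_right _ _) hd0.le zero_le_one
    rw [ht]
    linarith
  have hs : 10 * (n * Real.log n) ≤ m * t ^ 2 / 512 := by
    refine le_of_eq_of_le ?_ (div_le_div_of_nonneg_right
      (mul_le_mul_of_nonneg_right hm (sq_nonneg t)) (by norm_num))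
    rw [ht]
    field_simp
  obtain ⟨N, hNcard, hN1, hNnet⟩ := OneBitPhase.exists_net n
  let bad : Set Ω := ⋃ v ∈ N, {ω | t < |OneBitPhase.quadForm
    (OneBitPhase.weightedMatrix x₀ (fun p => a p ω) - OneBitPhase.meanMatrix x₀) v|}
  have hbad : P.real bad ≤ 2 / (n : ℝ) ^ 2 := by
    refine (MeasureTheory.measureReal_biUnion_finset_le _ _).trans
      (le_trans ?_ (OneBitPhase.card_mul_exp_le hn hs))
    refine (Finset.sum_le_card_nsmul _ _ _ fun v hv =>
      OneBitPhase.measure_abs_quadForm_gt_le hm0 hx₀ (hN1 v hv) ha hind ht0.le ht64).trans ?_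
    rw [nsmul_eq_mul]
    refine mul_le_mul_of_nonneg_right ?_ (by positivity)
    exact_mod_cast hNcard
  -- The vectors are measurable only almost everywhere, so `bad` is replaced by a measurable hull.
  refine ⟨(MeasureTheory.toMeasurable P bad)ᶜ,
    (MeasureTheory.measurableSet_toMeasurable P bad).compl, ?_, ?_⟩
  · rw [MeasureTheory.probReal_compl_eq_one_sub (MeasureTheory.measurableSet_toMeasurable P bad),
      MeasureTheory.measureReal_def, MeasureTheory.measure_toMeasurable,
      ← MeasureTheory.measureReal_def]
    linarith
  · intro ω hω x hx
    have hω' : ω ∉ bad := fun h => hω (MeasureTheory.subset_toMeasurable P bad h)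
    have hnet : ∀ v ∈ N, |OneBitPhase.quadForm
        (OneBitPhase.weightedMatrix x₀ (fun p => a p ω) - OneBitPhase.meanMatrix x₀) v| ≤ t := by
      intro v hv
      by_contra! h
      exact hω' (Set.mem_biUnion hv h)
    obtain ⟨φ, hφ, h⟩ := OneBitPhase.exists_phase_of_isTopEigenvector hx₀ hx
      fun u hu => OneBitPhase.abs_quadForm_le_of_net hN1 hNnet hnet hu
    refine ⟨φ, hφ, h.trans ?_⟩
    rw [div_le_iff₀ hgap, ht]
    have := mul_le_mul_of_nonneg_left (min_le_left g 1) hε.le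
    linarith
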